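/- **Theorem (termination and correctness of the F5GEN algorithm).** Let $k$ be a field, $R=k[x_1,\dots,x_n]$, let $\mathcal M$ be the monoid of monomials of $R$, let $\le_m$ be an admissible monomial order on $\mathcal M$, and let $F$ be a finite set (list) of polynomials in $R$. Interreduce $F$: as long as possible, cancel a term of one of the polynomials by a multiple of the leading term of another (nonzero) one, or drop a zero polynomial. This process terminates. Let $f_1,\dots,f_d$ be any of its results, sorted by ascending leading monomials. Let $\mathcal M_d=\{m\mathbf e_i\}$ be the set of module monomials of $R^d$. An *admissible module order* $\le_s$ is a linear order on $\mathcal M_d$ with $\mathbf e_i\le_s m\mathbf e_i$, and such that $\mathbf s\le_s\mathbf t$ implies $m\mathbf s\le_s m\mathbf t$, for all $m\in\mathcal M$, all $i$ and all $\mathbf s,\mathbf t\in\mathcal M_d$. It is *compatible* with $\le_m$ if $\sigma\mathbf e_j\le_s\tau\mathbf e_j\Leftrightarrow\sigma\le_m\tau$ for all $\sigma,\tau\in\mathcal M$ and all $j$. A *sig-polynomial* is a pair $(\mathbf u,p)\in R^d\times R$ with $\sum_i u_if_i=p$. Its *signature* is the $\le_s$-largest module monomial $lm(\mathbf u)$ occurring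 in $\mathbf u$; its *index* is the index $i$ of that module monomial. It is a *syzygy* if $p=0$. For non-syzygies $sp_1=(\mathbf u_1,p_1)$, $sp_2=(\mathbf u_2,p_2)$ put $m_i=\mathrm{lcm}(lm(p_1),lm(p_2))/lm(p_i)$. If $m_1lm(\mathbf u_1)>_sm_2lm(\mathbf u_2)$, then $m_1sp_1$ is the *J-pair* of $sp_1$ and $sp_2$ (in either order), with *first component* $sp_1$; if the two multiplied signatures agree, there is no J-pair. A *tm-reduction* of a non-syzygy $(\mathbf u,p)$ by a non-syzygy $(\mathbf u',p')$ replaces $(\mathbf u,p)$ by $(\mathbf u,p)-c\lambda(\mathbf u',p')$, where $\lambda\in\mathcal M$, $c\in k$, $c\lambda\, lt(p')=lt(p)$ and $\lambda\, lm(\mathbf u')<_slm(\mathbf u)$. A sig-polynomial $q$ *super top-reduces* $r$ if, for some $\lambda\in\mathcal M$, $\lambda$ times the signature of $q$ is the signature of $r$, and either both are syzygies, or neither is and $\lambda$ times the leading monomial of $q$ is the leading monomial of $r$. The *F5GEN algorithm*, started with $f_1,\dots,f_d$, keeps an ordered list $\mathcal{SG}'$, initially $F_1,\dots,F_d$ with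 $F_i=(\mathbf e_i,f_i)$; a set $\mathbf{PSyz}$ of principal syzygies, initially $\{(f_i\mathbf e_j-f_j\mathbf e_i,0) : i<j\}$; and a set $\mathbf{CPs}$ of J-pairs, initially the J-pairs of $F_i,F_j$ for $i<j$. While $\mathbf{CPs}\neq\emptyset$, it 1. removes from $\mathbf{CPs}$ a J-pair $cp=m\,sp_k$ of $\le_s$-minimal signature, where $sp_k$ is its first component; 2. discards $cp$ and returns to step 1 if the signature of $cp$ is divisible by the signature of an element of $\mathbf{PSyz}$, or if the last element of $\mathcal{SG}'$ whose signature divides that of $cp$ is not $sp_k$ (F5-rewritable); 3. otherwise tm-reduces $cp$ by elements of $\mathcal{SG}'$, chosen arbitrarily, until the result $sp=(\mathbf u,g)$ cannot be tm-reduced by $\mathcal{SG}'$; 4. inserts $sp$ into $\mathcal{SG}'$ at an arbitrary place after $sp_k$, within or at the border of the block of elements with the same index as $sp$; 5. if $g\ne0$, adds to $\mathbf{CPs}$ the J-pairs of $sp$ with all other non-syzygies of $\mathcal{SG}'$ and keeps for each signature only the J-pair whose first component comes last in $\mathcal{SG}'$; and adds to $\mathbf{PSyz}$ the nonzero ones among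 the principal syzygies $(g\mathbf u_l-g_l\mathbf u,0)$, with $(\mathbf u_l,g_l)$ a non-syzygy in $\mathcal{SG}'$, discarding from $\mathbf{PSyz}$ the elements super top-reducible by others (of several elements that super top-reduce each other one is kept). When $\mathbf{CPs}=\emptyset$, it returns $\{g\neq0 : (\mathbf u,g)\in\mathcal{SG}'\}$. Then for every admissible module order $\le_s$ compatible with $\le_m$, and whatever choices are made in the steps above, the F5GEN algorithm terminates after finitely many steps and returns a Gröbner basis of the ideal $\langle F\rangle$ with respect to $\le_m$. In particular, this holds for the algorithm to which the original F5 algorithm is reduced: if all elements of $F$ are homogeneous, then, for every admissible monomial order $\le_m$, the F5GEN algorithm with the following order $\le_{s_0}$, and with any insertion strategy as above, terminates after finitely many steps and returns a Gröbner basis of $\langle F\rangle$. Here $x^\alpha\mathbf e_i<_{s_0}x^\beta\mathbf e_j$ if $i<j$; or $i=j$ and $\deg x^\alpha+\deg lm(f_i)<\deg x^\beta+\deg lm(f_j)$; or $i=j$, these numbers are equal, and $x^\alpha<_mx^\beta$. -/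

import Mathlib

open MvPolynomial

namespace F5GEN

/-! ### Module monomials and admissible module orders -/

/-- The module monomial `x^mon • e_idx` of the free module `R ^ d`, where `R = k[x_1, …, x_n]`. -/
@[ext]
structure ModMon (n d : ℕ) where
  idx : Fin d
  mon : Fin n →₀ ℕ

/-- Multiplication of a module monomial by the monomial `x^t`. -/
noncomputable def ModMon.shift {n d : ℕ} (t : Fin n →₀ ℕ) (s : ModMon n d) : ModMon n d :=
  ⟨s.idx, t + s.mon⟩

/-- An admissible module order: a linear order on the module monomials with `e_i ≤ x^t e_i`
which is preserved by multiplication by monomials. -/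
structure ModuleOrder (n d : ℕ) where
  le : ModMon n d → ModMon n d → Prop
  le_refl : ∀ a, le a a
  le_trans : ∀ a b c, le a b → le b c → le a c
  le_antisymm : ∀ a b, le a b → le b a → a = b
  le_total : ∀ a b, le a b ∨ le b a
  unit_le : ∀ (i : Fin d) (t : Fin n →₀ ℕ), le ⟨i, 0⟩ ⟨i, t⟩
  shift_le : ∀ (t : Fin n →₀ ℕ) (a b : ModMon n d), le a b → le (a.shift t) (b.shift t)

/-- The strict part of an admissible module order. -/
def ModuleOrder.lt {n d : ℕ} (so : ModuleOrder n d) (a b : ModMon n d) : Prop :=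
  so.le a b ∧ a ≠ b

/-- The module order is compatible with the monomial order:
`x^a e_j ≤ x^b e_j` if and only if `x^a ≤ x^b`. -/
def ModuleOrder.Compatible {n d : ℕ} (so : ModuleOrder n d) (ord : MonomialOrder (Fin n)) :
    Prop :=
  ∀ (j : Fin d) (a b : Fin n →₀ ℕ), so.le ⟨j, a⟩ ⟨j, b⟩ ↔ ord.toSyn a ≤ ord.toSyn b

/-! ### Sig-polynomials, signatures and leading monomials -/

/-- A pair `(u, p)` in `R ^ d × R`. Those with `u • f = p` are the sig-polynomials; all pairs
that occur in a run of the algorithm have this property. -/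
abbrev SigPoly (k : Type*) [Field k] (n d : ℕ) :=
  (Fin d → MvPolynomial (Fin n) k) × MvPolynomial (Fin n) k

section
variable {k : Type*} [Field k] {n d : ℕ}

/-- `s` is the signature of `q = (u, p)`: the largest module monomial that occurs in `u`. -/
def IsSig (so : ModuleOrder n d) (q : SigPoly k n d) (s : ModMon n d) : Prop :=
  s.mon ∈ (q.1 s.idx).support ∧ ∀ t : ModMon n d, t.mon ∈ (q.1 t.idx).support → so.le t s

/-- The signature of `q` divides the signature of `r`. -/
def SigDvd (so : ModuleOrder n d) (q r : SigPoly k n d) : Prop :=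
  ∃ s t, IsSig so q s ∧ IsSig so r (s.shift t)

/-- `q` and `r` have the same signature. -/
def SameSig (so : ModuleOrder n d) (q r : SigPoly k n d) : Prop :=
  ∃ s, IsSig so q s ∧ IsSig so r s

/-- The signatures of `q` and `r` have the same index. -/
def SameIdx (so : ModuleOrder n d) (q r : SigPoly k n d) : Prop :=
  ∃ s s', IsSig so q s ∧ IsSig so r s' ∧ s.idx = s'.idx

/-- `LM(q) ≺_{s,m} LM(r)`: `q` ts-rewrites `r`. -/
def TsRewrites (ord : MonomialOrder (Fin n)) (so : ModuleOrder n d) (q r : SigPoly k n d) :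
    Prop :=
  r.2 ≠ 0 ∧ ∃ s t, IsSig so q s ∧ IsSig so r (s.shift t) ∧
    (q.2 = 0 ∨ ord.toSyn (t + ord.degree q.2) < ord.toSyn (ord.degree r.2))

/-- `LM(q) ∣ LM(r)`: `q` super top-reduces `r`. -/
def SuperReduces (ord : MonomialOrder (Fin n)) (so : ModuleOrder n d) (q r : SigPoly k n d) :
    Prop :=
  ∃ s t, IsSig so q s ∧ IsSig so r (s.shift t) ∧
    ((q.2 = 0 ∧ r.2 = 0) ∨ (q.2 ≠ 0 ∧ r.2 ≠ 0 ∧ t + ord.degree q.2 = ord.degree r.2))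

/-- `LM(q) ≺_{m,s} LM(r)` with quotient `x^t` of the leading monomials: `r` can be tm-reduced
by `x^t q`. -/
def TmReducesAt (ord : MonomialOrder (Fin n)) (so : ModuleOrder n d) (q r : SigPoly k n d)
    (t : Fin n →₀ ℕ) : Prop :=
  q.2 ≠ 0 ∧ r.2 ≠ 0 ∧ t + ord.degree q.2 = ord.degree r.2 ∧
    ∃ s s', IsSig so q s ∧ IsSig so r s' ∧ so.lt (s.shift t) s'

/-- One tm-reduction step of `r` by an element of the list `SG`, with result `r'`. -/
def TmStep (ord : MonomialOrder (Fin n)) (so : ModuleOrder n d) (SG : List (SigPoly k n d))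
    (r r' : SigPoly k n d) : Prop :=
  ∃ q ∈ SG, ∃ t, TmReducesAt ord so q r t ∧
    r' = r - (monomial t (ord.leadingCoeff r.2 / ord.leadingCoeff q.2) :
      MvPolynomial (Fin n) k) • q

/-! ### J-pairs -/

/-- The J-pair `x^mult • first`, recorded together with its first component. -/
structure CritPair (k : Type*) [Field k] (n d : ℕ) where
  mult : Fin n →₀ ℕ
  first : SigPoly k n d

/-- The sig-polynomial `x^mult • first`. -/
noncomputable def CritPair.toSigPoly (c : CritPair k n d) : SigPoly k n d :=
  (monomial c.mult (1 : k) : MvPolynomial (Fin n) k) • c.first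

/-- The multiplier `lcm (lm p_a, lm p_b) / lm p_a` of `a` in the J-pair of `a` and `b`. -/
noncomputable def multiplier (ord : MonomialOrder (Fin n)) (a b : SigPoly k n d) :
    Fin n →₀ ℕ :=
  (ord.degree a.2 ⊔ ord.degree b.2) - ord.degree a.2

/-- `a` and `b` are non-syzygies and `a` is the first component of their J-pair. -/
def IsFirst (ord : MonomialOrder (Fin n)) (so : ModuleOrder n d) (a b : SigPoly k n d) : Prop :=
  a.2 ≠ 0 ∧ b.2 ≠ 0 ∧ ∃ s s', IsSig so a s ∧ IsSig so b s' ∧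
    so.lt (s'.shift (multiplier ord b a)) (s.shift (multiplier ord a b))

open Classical in
/-- The J-pair of `a` and `b` as a set with at most one element; it is empty when the two
multiplied signatures agree or one of the components is a syzygy. -/
noncomputable def jPair (ord : MonomialOrder (Fin n)) (so : ModuleOrder n d)
    (a b : SigPoly k n d) : Finset (CritPair k n d) :=
  if IsFirst ord so a b then {⟨multiplier ord a b, a⟩}
  else if IsFirst ord so b a then {⟨multiplier ord b a, b⟩}
  else ∅

/-- `(p_a u_b - p_b u_a, 0)`. -/
noncomputable def principalSyz (a b : SigPoly k n d) : SigPoly k n d :=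
  (a.2 • b.1 - b.2 • a.1, 0)

/-! ### The subroutines of the algorithm -/

/-- `cp = m • first` is F5-rewritable by the list `SG`: going through `SG` from the end, the
first element met whose signature divides that of `cp` is not the first component of `cp`. -/
def F5Rewritable (so : ModuleOrder n d) (SG : List (SigPoly k n d)) (cp : CritPair k n d) :
    Prop :=
  ∃ A q B, SG = A ++ q :: B ∧ SigDvd so q cp.toSigPoly ∧
    (∀ r ∈ B, ¬ SigDvd so r cp.toSigPoly) ∧ q ≠ cp.first

/-- `SG'` is obtained from `SG` by inserting `sp` at some position after the first component of
`cp` and inside the block of the elements with the same index as `sp`, that is, neither before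
the element preceding the first such element nor behind the last one. -/
def InsertF5GEN (so : ModuleOrder n d) (sp : SigPoly k n d) (cp : CritPair k n d)
    (SG SG' : List (SigPoly k n d)) : Prop :=
  ∃ A B, SG = A ++ B ∧ SG' = A ++ sp :: B ∧ cp.first ∈ A ∧
    ((∃ r ∈ A, SameIdx so r sp) ∨ ∃ r B', B = r :: B' ∧ SameIdx so r sp) ∧
    ((∃ r ∈ B, SameIdx so r sp) ∨ ∃ A' r, A = A' ++ [r] ∧ SameIdx so r sp)

open Classical in
/-- Keep, for each signature, only the J-pair whose first component comes last in `SG`. -/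
noncomputable def storeOne (so : ModuleOrder n d) (SG : List (SigPoly k n d))
    (C : Finset (CritPair k n d)) : Finset (CritPair k n d) :=
  C.filter fun c => ¬ ∃ c' ∈ C, SameSig so c.toSigPoly c'.toSigPoly ∧
    [c.first, c'.first].Sublist SG

open Classical in
/-- The J-pairs of `sp` with the other non-syzygies of the list `SG`. -/
noncomputable def newPairs (ord : MonomialOrder (Fin n)) (so : ModuleOrder n d)
    (SG : List (SigPoly k n d)) (sp : SigPoly k n d) : Finset (CritPair k n d) :=
  (SG.toFinset.filter fun q => q.2 ≠ 0 ∧ q ≠ sp).biUnion fun q => jPair ord so sp q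

open Classical in
/-- The nonzero principal syzygies of `sp` with the non-syzygies of the list `SG`. -/
noncomputable def newSyz (SG : List (SigPoly k n d)) (sp : SigPoly k n d) :
    Finset (SigPoly k n d) :=
  ((SG.toFinset.filter fun q => q.2 ≠ 0).image fun q => principalSyz sp q).erase 0

/-- `P'` is obtained from `P` by discarding the elements that are super top-reducible by other
ones; of several elements that super top-reduce each other one is kept. -/
def DiscardSuper (ord : MonomialOrder (Fin n)) (so : ModuleOrder n d)
    (P P' : Finset (SigPoly k n d)) : Prop :=
  P' ⊆ P ∧ (∀ z ∈ P, ∃ z' ∈ P', SuperReduces ord so z' z) ∧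
    ∀ z ∈ P', ∀ z' ∈ P', z' ≠ z → ¬ SuperReduces ord so z' z

/-! ### The algorithm as a transition system -/

/-- The states of the F5GEN algorithm. -/
inductive State (k : Type*) [Field k] (n d : ℕ)
  /-- At the head of the while-loop: the ordered list `SG'`, the principal syzygies `PSyz`
  and the J-pairs `CPs`. -/
  | loop (SG : List (SigPoly k n d)) (P : Finset (SigPoly k n d))
      (C : Finset (CritPair k n d)) : State k n d
  /-- During the tm-reduction of the selected J-pair `cp`; the current intermediate result
  is `sp`. -/
  | reducing (SG : List (SigPoly k n d)) (P : Finset (SigPoly k n d))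
      (C : Finset (CritPair k n d)) (cp : CritPair k n d) (sp : SigPoly k n d) : State k n d
  /-- The algorithm has returned the set `G`. -/
  | done (G : Set (MvPolynomial (Fin n) k)) : State k n d

/-- `(e_i, f_i)`. -/
noncomputable def unitSig (f : Fin d → MvPolynomial (Fin n) k) (i : Fin d) : SigPoly k n d :=
  (Pi.single i 1, f i)

open Classical in
/-- The state after the initialisation. -/
noncomputable def initial (ord : MonomialOrder (Fin n)) (so : ModuleOrder n d)
    (f : Fin d → MvPolynomial (Fin n) k) : State k n d :=
  let pairs : Finset (Fin d × Fin d) := Finset.univ.filter fun p => p.1 < p.2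
  .loop (List.ofFn (unitSig f))
    (pairs.image fun p => principalSyz (unitSig f p.1) (unitSig f p.2))
    (pairs.biUnion fun p => jPair ord so (unitSig f p.1) (unitSig f p.2))

/-- `cp` is an element of `C` of minimal signature. -/
def IsMinPair (so : ModuleOrder n d) (C : Finset (CritPair k n d)) (cp : CritPair k n d) :
    Prop :=
  cp ∈ C ∧ ∀ c ∈ C, ∃ s s', IsSig so cp.toSigPoly s ∧ IsSig so c.toSigPoly s' ∧ so.le s s'

/-- `cp` is ts-rewritable by `P` or F5-rewritable by `SG`. -/
def Rejected (ord : MonomialOrder (Fin n)) (so : ModuleOrder n d) (SG : List (SigPoly k n d))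
    (P : Finset (SigPoly k n d)) (cp : CritPair k n d) : Prop :=
  (∃ z ∈ P, TsRewrites ord so z cp.toSigPoly) ∨ F5Rewritable so SG cp

open Classical in
/-- The elementary steps of the F5GEN algorithm. The steps are not deterministic: the algorithm
does not prescribe the reducers, nor the place of insertion beyond `InsertF5GEN`. -/
inductive Step (ord : MonomialOrder (Fin n)) (so : ModuleOrder n d) :
    State k n d → State k n d → Prop
  /-- Take a J-pair of minimal signature; it is rejected by one of the criteria. -/
  | reject (SG : List (SigPoly k n d)) (P : Finset (SigPoly k n d))
      (C : Finset (CritPair k n d)) (cp : CritPair k n d)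
      (hmin : IsMinPair so C cp) (hrej : Rejected ord so SG P cp) :
      Step ord so (.loop SG P C) (.loop SG P (C.erase cp))
  /-- Take a J-pair of minimal signature; it passes the criteria. -/
  | select (SG : List (SigPoly k n d)) (P : Finset (SigPoly k n d))
      (C : Finset (CritPair k n d)) (cp : CritPair k n d)
      (hmin : IsMinPair so C cp) (hrej : ¬ Rejected ord so SG P cp) :
      Step ord so (.loop SG P C) (.reducing SG P (C.erase cp) cp cp.toSigPoly)
  /-- One tm-reduction by an element of `SG'`. -/
  | tmReduce (SG : List (SigPoly k n d)) (P : Finset (SigPoly k n d))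
      (C : Finset (CritPair k n d)) (cp : CritPair k n d) (sp sp' : SigPoly k n d)
      (h : TmStep ord so SG sp sp') :
      Step ord so (.reducing SG P C cp sp) (.reducing SG P C cp sp')
  /-- The result `sp` of the tm-reduction is a syzygy: insert it into `SG'`. -/
  | insertSyz (SG SG' : List (SigPoly k n d)) (P : Finset (SigPoly k n d))
      (C : Finset (CritPair k n d)) (cp : CritPair k n d) (sp : SigPoly k n d)
      (hirr : ∀ sp', ¬ TmStep ord so SG sp sp') (hins : InsertF5GEN so sp cp SG SG')
      (hzero : sp.2 = 0) :
      Step ord so (.reducing SG P C cp sp) (.loop SG' P C)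
  /-- The result `sp` of the tm-reduction is not a syzygy: insert it into `SG'` and update
  the J-pairs and the principal syzygies. -/
  | insertNonSyz (SG SG' : List (SigPoly k n d)) (P P' : Finset (SigPoly k n d))
      (C : Finset (CritPair k n d)) (cp : CritPair k n d) (sp : SigPoly k n d)
      (hirr : ∀ sp', ¬ TmStep ord so SG sp sp') (hins : InsertF5GEN so sp cp SG SG')
      (hzero : sp.2 ≠ 0) (hP : DiscardSuper ord so (P ∪ newSyz SG' sp) P') :
      Step ord so (.reducing SG P C cp sp)
        (.loop SG' P' (storeOne so SG' (C ∪ newPairs ord so SG' sp)))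
  /-- No J-pair is left: return the nonzero polynomial parts of `SG'`. -/
  | finish (SG : List (SigPoly k n d)) (P : Finset (SigPoly k n d)) :
      Step ord so (.loop SG P ∅) (.done {g | g ≠ 0 ∧ ∃ q ∈ SG, q.2 = g})

end

/-! ### Interreduction, termination and Gröbner bases -/

section
variable {k : Type*} [Field k] {n : ℕ}

/-- One step of the interreduction of a list of polynomials: cancel a term of one of them by a
multiple of another one, or drop a zero polynomial. -/
inductive InterreduceStep (ord : MonomialOrder (Fin n)) :
    List (MvPolynomial (Fin n) k) → List (MvPolynomial (Fin n) k) → Prop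
  | reduce (A B : List (MvPolynomial (Fin n) k)) (f g : MvPolynomial (Fin n) k)
      (t : Fin n →₀ ℕ) (hg : g ∈ A ++ B) (hg0 : g ≠ 0)
      (ht : t + ord.degree g ∈ f.support) :
      InterreduceStep ord (A ++ f :: B)
        (A ++ (f - monomial t (f.coeff (t + ord.degree g) / ord.leadingCoeff g) * g) :: B)
  | drop (A B : List (MvPolynomial (Fin n) k)) :
      InterreduceStep ord (A ++ 0 :: B) (A ++ B)

/-- `f_1, …, f_d` is the result of interreducing the list `F` until no step is possible and of
sorting by ascending leading monomials. -/
def IsSortedInterreduction (ord : MonomialOrder (Fin n)) (F : List (MvPolynomial (Fin n) k))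
    {d : ℕ} (f : Fin d → MvPolynomial (Fin n) k) : Prop :=
  (∃ L, Relation.ReflTransGen (InterreduceStep ord) F L ∧
    (∀ L', ¬ InterreduceStep ord L L') ∧ (List.ofFn f).Perm L) ∧
  ∀ i j, i ≤ j → ord.toSyn (ord.degree (f i)) ≤ ord.toSyn (ord.degree (f j))

/-- Every run of the transition system `step` from `x` is finite. -/
def Terminates {α : Type*} (step : α → α → Prop) (x : α) : Prop :=
  ¬ ∃ run : ℕ → α, run 0 = x ∧ ∀ i, step (run i) (run (i + 1))

/-- `G` is a (finite) Gröbner basis of the ideal `I`. -/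
def IsGroebnerBasis (ord : MonomialOrder (Fin n)) (G : Set (MvPolynomial (Fin n) k))
    (I : Ideal (MvPolynomial (Fin n) k)) : Prop :=
  G.Finite ∧ G ⊆ I ∧ ∀ p ∈ I, p ≠ 0 → ∃ g ∈ G, g ≠ 0 ∧ ord.degree g ≤ ord.degree p

/-- The main part of the F5GEN algorithm, started with `f_1, …, f_d`, terminates after finitely
many steps, and whenever it stops it has returned a Gröbner basis of `I`. -/
def ComputesGroebnerBasis {d : ℕ} (ord : MonomialOrder (Fin n)) (so : ModuleOrder n d)
    (f : Fin d → MvPolynomial (Fin n) k) (I : Ideal (MvPolynomial (Fin n) k)) : Prop :=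
  Terminates (Step ord so) (initial ord so f) ∧
  ∀ S, Relation.ReflTransGen (Step ord so) (initial ord so f) S →
    (∀ S', ¬ Step ord so S S') → ∃ G, S = .done G ∧ IsGroebnerBasis ord G I

/-! ### The module order of the original F5 algorithm -/

/-- The g-weighted degree `deg x^t + deg lm(f_i)` of `x^t e_i`. -/
noncomputable def gwDeg {d : ℕ} (ord : MonomialOrder (Fin n))
    (f : Fin d → MvPolynomial (Fin n) k) (a : ModMon n d) : ℕ :=
  a.mon.degree + (ord.degree (f a.idx)).degree

/-- Compare the indices first, then the g-weighted degrees, then the monomials. -/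
noncomputable def f5Order {d : ℕ} (ord : MonomialOrder (Fin n))
    (f : Fin d → MvPolynomial (Fin n) k) : ModuleOrder n d where
  le a b := a.idx < b.idx ∨ (a.idx = b.idx ∧ (gwDeg ord f a < gwDeg ord f b ∨
    (gwDeg ord f a = gwDeg ord f b ∧ ord.toSyn a.mon ≤ ord.toSyn b.mon)))
  le_refl a := by simp
  le_trans a b c := by
    rintro (h | ⟨h, h' | ⟨h', h''⟩⟩) (g | ⟨g, g' | ⟨g', g''⟩⟩)
    · exact .inl (h.trans g)
    · exact .inl (g ▸ h)
    · exact .inl (g ▸ h)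
    · exact .inl (h ▸ g)
    · exact .inr ⟨h.trans g, .inl (h'.trans g')⟩
    · exact .inr ⟨h.trans g, .inl (g' ▸ h')⟩
    · exact .inl (h ▸ g)
    · exact .inr ⟨h.trans g, .inl (h' ▸ g')⟩
    · exact .inr ⟨h.trans g, .inr ⟨h'.trans g', h''.trans g''⟩⟩
  le_antisymm a b := by
    rintro (h | ⟨h, h' | ⟨h', h''⟩⟩) (g | ⟨g, g' | ⟨g', g''⟩⟩)
    · exact absurd g h.asymm
    · exact absurd g h.ne'
    · exact absurd g h.ne'
    · exact absurd h g.ne'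
    · omega
    · omega
    · exact absurd h g.ne'
    · omega
    · exact ModMon.ext h (ord.toSyn.injective (_root_.le_antisymm h'' g''))
  le_total a b := by
    rcases lt_trichotomy a.idx b.idx with h | h | h
    · exact .inl (.inl h)
    · rcases lt_trichotomy (gwDeg ord f a) (gwDeg ord f b) with h' | h' | h'
      · exact .inl (.inr ⟨h, .inl h'⟩)
      · rcases _root_.le_total (ord.toSyn a.mon) (ord.toSyn b.mon) with h'' | h''
        · exact .inl (.inr ⟨h, .inr ⟨h', h''⟩⟩)
        · exact .inr (.inr ⟨h.symm, .inr ⟨h'.symm, h''⟩⟩)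
      · exact .inr (.inr ⟨h.symm, .inl h'⟩)
    · exact .inr (.inl h)
  unit_le i t := by
    refine .inr ⟨rfl, ?_⟩
    rcases Nat.eq_zero_or_pos t.degree with h | h
    · exact .inr ⟨by simp [gwDeg, h], ord.toSyn_monotone (bot_le : (0 : Fin n →₀ ℕ) ≤ t)⟩
    · exact .inl (by simpa [gwDeg] using h)
  shift_le t a b := by
    rintro (h | ⟨h, h' | ⟨h', h''⟩⟩)
    · exact .inl h
    · refine .inr ⟨h, .inl ?_⟩
      simp only [gwDeg, ModMon.shift, map_add] at h' ⊢
      omega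
    · refine .inr ⟨h, .inr ⟨?_, ?_⟩⟩
      · simp only [gwDeg, ModMon.shift, map_add] at h' ⊢
        omega
      · simp only [ModMon.shift, map_add]
        gcongr

end

end F5GEN

/-! Correctness is an induction on signatures. Call a module monomial `T` settled if the signature
of a syzygy divides it, or if some multiple of a list element has signature `T` and the least
leading monomial among all non-syzygies of signature `T` (`AttainsMin`). If everything up to `T` is
settled, the leading monomial of any non-syzygy of signature `T` is that of a multiple of a list
element with signature at most `T`: subtracting a non-minimal competitor of equal signature lowers
the signature and keeps the leading monomial (`exists_reducer_of_attainsMin`). To settle `T`, take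
the last list element whose signature divides `T`. If its multiple were not minimal, it would be
tm-reducible, hence a multiple of a J-pair; a treated J-pair leaves a later element, or a syzygy,
whose signature divides `T`, a contradiction (`attainsMin_of_covered`). `LoopInv` records that each
J-pair is pending or treated in this sense. Every element of the ideal is the polynomial part of a
sig-polynomial, so the final list gives a Gröbner basis.

For termination, make each inserted element a child of the first component of its J-pair. An element
has finitely many children: by Dickson's lemma some multiplier divides a later one, and the later
J-pair is then F5-rewritable (`finite_child`). No branch is infinite: along it the quotient of
leading monomial by signature strictly decreases, and Dickson's lemma yields an ancestor that
tm-reduces a descendant, which was inserted as irreducible (`wellFounded_child`). Compatibility of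
the orders enters here. The F5 order need not be compatible, but for homogeneous input it only has
to compare module monomials of equal g-weighted degree, where it agrees with the monomial order.
Hence only finitely many elements ever occur; each insertion brings a new one
(`ReducingInv.notMem`), and between insertions a measure drops.

Interreduction terminates by the Dershowitz–Manna order on the multiset of all monomials. It keeps
the ideal and homogeneity, and leaves no zero polynomial. -/

namespace F5GEN

/-! ### Admissible module orders. -/

section ModuleOrder
variable {n d : ℕ} (so : ModuleOrder n d)

namespace ModuleOrder

variable {so} {a b c : ModMon n d}

lemma lt_irrefl (a : ModMon n d) : ¬ so.lt a a := fun h => h.2 rfl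

lemma lt_of_lt_of_le (h : so.lt a b) (h' : so.le b c) : so.lt a c :=
  ⟨so.le_trans _ _ _ h.1 h', by rintro rfl; exact h.2 (so.le_antisymm _ _ h.1 h')⟩

lemma lt_of_le_of_lt (h : so.le a b) (h' : so.lt b c) : so.lt a c :=
  ⟨so.le_trans _ _ _ h h'.1, by rintro rfl; exact h'.2 (so.le_antisymm _ _ h'.1 h)⟩

lemma lt_trans (h : so.lt a b) (h' : so.lt b c) : so.lt a c := lt_of_lt_of_le h h'.1

lemma not_le_of_lt (h : so.lt a b) : ¬ so.le b a := fun h' => lt_irrefl _ (lt_of_lt_of_le h h')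

lemma lt_of_not_le (h : ¬ so.le b a) : so.lt a b :=
  ⟨(so.le_total a b).resolve_right h, by rintro rfl; exact h (so.le_refl _)⟩

lemma lt_or_eq_of_le (h : so.le a b) : so.lt a b ∨ a = b := by
  by_cases e : a = b
  · exact .inr e
  · exact .inl ⟨h, e⟩

end ModuleOrder

@[simp] lemma ModMon.shift_zero (s : ModMon n d) : s.shift 0 = s := by simp [ModMon.shift]

@[simp] lemma ModMon.shift_idx (t : Fin n →₀ ℕ) (s : ModMon n d) : (s.shift t).idx = s.idx := rfl

@[simp] lemma ModMon.shift_mon (t : Fin n →₀ ℕ) (s : ModMon n d) :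
    (s.shift t).mon = t + s.mon := rfl

lemma ModMon.shift_shift (t t' : Fin n →₀ ℕ) (s : ModMon n d) :
    (s.shift t).shift t' = s.shift (t' + t) := by simp [ModMon.shift, add_assoc]

lemma ModMon.shift_injective (t : Fin n →₀ ℕ) :
    Function.Injective (ModMon.shift t : ModMon n d → ModMon n d) := by
  intro a b h
  have h1 := congrArg ModMon.idx h
  have h2 := congrArg ModMon.mon h
  exact ModMon.ext h1 (add_left_cancel h2)

namespace ModuleOrder
variable {so} {a b : ModMon n d}

lemma shift_lt (t : Fin n →₀ ℕ) (h : so.lt a b) : so.lt (a.shift t) (b.shift t) :=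
  ⟨so.shift_le t _ _ h.1, fun e => h.2 (ModMon.shift_injective t e)⟩

lemma lt_of_shift_lt (t : Fin n →₀ ℕ) (h : so.lt (a.shift t) (b.shift t)) : so.lt a b :=
  lt_of_not_le fun h' => not_le_of_lt h (so.shift_le t _ _ h')

lemma le_shift (t : Fin n →₀ ℕ) (a : ModMon n d) : so.le a (a.shift t) := by
  have := so.shift_le a.mon _ _ (so.unit_le a.idx t)
  simpa [ModMon.shift, add_comm] using this

lemma lt_shift {t : Fin n →₀ ℕ} (ht : t ≠ 0) (a : ModMon n d) : so.lt a (a.shift t) :=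
  ⟨le_shift t a, fun e => ht (by simpa [ModMon.shift] using congrArg ModMon.mon e)⟩

/-- An admissible module order is a well-order, by Dickson's lemma. -/
lemma wellFounded_lt (so : ModuleOrder n d) : WellFounded so.lt := by
  rw [wellFounded_iff_isEmpty_descending_chain]
  refine ⟨fun ⟨s, hs⟩ => ?_⟩
  have hanti : ∀ i j, i < j → so.lt (s j) (s i) := by
    intro i j hij
    induction hij with
    | refl => exact hs i
    | step _ ih => exact lt_trans (hs _) ih
  obtain ⟨i, j, hij, h1, h2⟩ :=
    WellQuasiOrdered.prod (Finite.wellQuasiOrdered (α := Fin d) (· = ·))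
      (wellQuasiOrdered_le (α := Fin n →₀ ℕ)) fun i => ((s i).idx, (s i).mon)
  refine not_le_of_lt (hanti i j hij) ?_
  have : s j = (s i).shift ((s j).mon - (s i).mon) :=
    ModMon.ext h1.symm (tsub_add_cancel_of_le h2).symm
  rw [this]
  exact le_shift _ _

end ModuleOrder
end ModuleOrder

/-! ### Signatures and their cancellation. -/

section Signature
variable {k : Type*} [Field k] {n d : ℕ} {so : ModuleOrder n d}

lemma IsSig.unique {q : SigPoly k n d} {s s' : ModMon n d} (h : IsSig so q s)
    (h' : IsSig so q s') : s = s' :=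
  so.le_antisymm _ _ (h'.2 _ h.1) (h.2 _ h'.1)

lemma exists_isSig (so : ModuleOrder n d) {q : SigPoly k n d} (h : q.1 ≠ 0) :
    ∃ s, IsSig so q s := by
  let S : Set (ModMon n d) := {t | t.mon ∈ (q.1 t.idx).support}
  have hfin : S.Finite := by
    refine (Set.finite_iUnion fun i : Fin d =>
      ((q.1 i).support.finite_toSet.image fun m => (⟨i, m⟩ : ModMon n d))).subset ?_
    intro t ht
    exact Set.mem_iUnion.2 ⟨t.idx, t.mon, ht, rfl⟩
  have hne : S.Nonempty := by
    obtain ⟨i, hi⟩ := Function.ne_iff.1 h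
    obtain ⟨m, hm⟩ := support_nonempty.2 hi
    exact ⟨⟨i, m⟩, hm⟩
  let : Preorder (ModMon n d) :=
    { le := so.le, le_refl := so.le_refl, le_trans := so.le_trans }
  obtain ⟨s, hs⟩ := hfin.exists_maximal hne
  refine ⟨s, hs.prop, fun t ht => ?_⟩
  rcases so.le_total t s with h | h
  · exact h
  · exact hs.le_of_ge ht h

lemma IsSig.ne_zero {q : SigPoly k n d} {s : ModMon n d} (h : IsSig so q s) : q.1 ≠ 0 := by
  intro e
  have := h.1
  simp [e] at this

lemma IsSig.monomial_smul {q : SigPoly k n d} {s : ModMon n d} (h : IsSig so q s)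
    (t : Fin n →₀ ℕ) {c : k} (hc : c ≠ 0) :
    IsSig so ((monomial t c : MvPolynomial (Fin n) k) • q) (s.shift t) := by
  refine ⟨?_, fun r hr => ?_⟩
  · have := h.1
    simp only [Prod.smul_fst, Pi.smul_apply, smul_eq_mul, mem_support_iff, ModMon.shift_idx,
      ModMon.shift_mon, coeff_monomial_mul] at this ⊢
    exact mul_ne_zero hc this
  · simp only [Prod.smul_fst, Pi.smul_apply, smul_eq_mul, mem_support_iff,
      coeff_monomial_mul'] at hr
    split_ifs at hr with hle
    · have h1 := so.shift_le t _ _ (h.2 ⟨r.idx, r.mon - t⟩ (mem_support_iff.2 (right_ne_zero_of_mul hr)))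
      simpa [ModMon.shift, add_tsub_cancel_of_le hle] using h1
    · exact absurd rfl hr

/-- All module monomials that occur in `q` are smaller than `s`. -/
def SigLT (so : ModuleOrder n d) (q : SigPoly k n d) (s : ModMon n d) : Prop :=
  ∀ t : ModMon n d, t.mon ∈ (q.1 t.idx).support → so.lt t s

lemma IsSig.sigLT {q : SigPoly k n d} {s s' : ModMon n d} (h : IsSig so q s) (hs : so.lt s s') :
    SigLT so q s' := fun t ht => ModuleOrder.lt_of_le_of_lt (h.2 t ht) hs

lemma SigLT.lt {q : SigPoly k n d} {s s' : ModMon n d} (h : SigLT so q s') (hs : IsSig so q s) :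
    so.lt s s' := h _ hs.1

lemma IsSig.sub {q r : SigPoly k n d} {s : ModMon n d} (h : IsSig so q s)
    (hr : SigLT so r s) : IsSig so (q - r) s := by
  have h0 : coeff s.mon (r.1 s.idx) = 0 := by
    by_contra h0
    exact ModuleOrder.lt_irrefl _ (hr s (mem_support_iff.2 h0))
  refine ⟨?_, fun t ht => ?_⟩
  · have := h.1
    simpa [mem_support_iff, h0] using this
  · by_contra hlt
    have hlt' := ModuleOrder.lt_of_not_le fun h' => hlt h'
    have h1 : coeff t.mon (q.1 t.idx) = 0 := by
      by_contra h1
      exact hlt (h.2 t (mem_support_iff.2 h1))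
    have h2 : coeff t.mon (r.1 t.idx) = 0 := by
      by_contra h2
      exact hlt (hr t (mem_support_iff.2 h2)).1
    simp [mem_support_iff, h1, h2] at ht

/-- The quotient of the two coefficients at `s` cancels the top terms. The difference may have a
zero module part and so no signature; hence the bound is stated with `SigLT`. -/
lemma IsSig.exists_sigLT_sub {q r : SigPoly k n d} {s : ModMon n d} (hq : IsSig so q s)
    (hr : IsSig so r s) : ∃ c : k, c ≠ 0 ∧
      SigLT so (q - (monomial 0 c : MvPolynomial (Fin n) k) • r) s := by
  have h1 := mem_support_iff.1 hq.1
  have h2 := mem_support_iff.1 hr.1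
  refine ⟨_, div_ne_zero h1 h2, fun t ht => ⟨?_, ?_⟩⟩
  · by_contra hlt
    have h3 : coeff t.mon (q.1 t.idx) = 0 := by
      by_contra h1
      exact hlt (hq.2 t (mem_support_iff.2 h1))
    have h4 : coeff t.mon (r.1 t.idx) = 0 := by
      by_contra h1
      exact hlt (hr.2 t (mem_support_iff.2 h1))
    simp [mem_support_iff, h3, h4, coeff_C_mul, monomial_zero'] at ht
  · rintro rfl
    simp [mem_support_iff, coeff_C_mul, monomial_zero', div_mul_cancel₀ _ h2] at ht

end Signature

/-! ### Leading monomials under subtraction. -/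

section Degree
variable {k : Type*} [Field k] {n : ℕ} (ord : MonomialOrder (Fin n))

lemma degree_monomial_mul {p : MvPolynomial (Fin n) k} (hp : p ≠ 0) (t : Fin n →₀ ℕ) {c : k}
    (hc : c ≠ 0) : ord.degree (monomial t c * p) = t + ord.degree p := by
  classical
  rw [ord.degree_mul (by simpa using hc) hp, ord.degree_monomial, if_neg hc]

/-- Cancelling the leading term gives zero or a polynomial with smaller leading monomial. -/
lemma degree_sub_monomial_mul_lt {p q : MvPolynomial (Fin n) k} (hp : p ≠ 0) (hq : q ≠ 0)
    {t : Fin n →₀ ℕ} (h : t + ord.degree q = ord.degree p)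
    (h0 : p - monomial t (ord.leadingCoeff p / ord.leadingCoeff q) * q ≠ 0) :
    ord.toSyn (ord.degree (p - monomial t (ord.leadingCoeff p / ord.leadingCoeff q) * q)) <
      ord.toSyn (ord.degree p) := by
  have hq' := ord.leadingCoeff_ne_zero_iff.2 hq
  have hp' := ord.leadingCoeff_ne_zero_iff.2 hp
  set r := monomial t (ord.leadingCoeff p / ord.leadingCoeff q) * q with hr
  have hdr : ord.degree r = ord.degree p := by
    rw [hr, degree_monomial_mul ord hq t (div_ne_zero hp' hq'), h]
  have hmem := ord.degree_mem_support h0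
  refine lt_of_le_of_ne ?_ ?_
  · by_contra hlt
    rw [not_le] at hlt
    rw [mem_support_iff, coeff_sub, ord.coeff_eq_zero_of_lt hlt,
      ord.coeff_eq_zero_of_lt (hdr ▸ hlt)] at hmem
    simp at hmem
  · intro e
    rw [ord.toSyn.injective e, mem_support_iff, coeff_sub] at hmem
    apply hmem
    rw [hr, ← h, coeff_monomial_mul, h]
    have : coeff (ord.degree q) q = ord.leadingCoeff q := rfl
    rw [this, div_mul_cancel₀ _ hq']
    exact sub_self _

lemma degree_sub_eq_of_lt {p q : MvPolynomial (Fin n) k}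
    (h : ord.toSyn (ord.degree q) < ord.toSyn (ord.degree p)) :
    p - q ≠ 0 ∧ ord.degree (p - q) = ord.degree p := by
  have hd : ord.degree (p - q) = ord.degree p := by
    apply ord.degree_sub_of_lt h
  refine ⟨fun e => ?_, hd⟩
  rw [sub_eq_zero.1 e] at h
  exact h.false

end Degree

/-! ### Sig-polynomials. -/

section IsSigPoly
variable {k : Type*} [Field k] {n d : ℕ}

/-- `q = (u, p)` with `u • f = p`. -/
def IsSigPoly (f : Fin d → MvPolynomial (Fin n) k) (q : SigPoly k n d) : Prop :=
  ∑ i, q.1 i * f i = q.2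

variable {f : Fin d → MvPolynomial (Fin n) k} {q r : SigPoly k n d}

lemma IsSigPoly.smul (h : IsSigPoly f q) (p : MvPolynomial (Fin n) k) : IsSigPoly f (p • q) := by
  simp only [IsSigPoly, Prod.smul_fst, Prod.smul_snd, Pi.smul_apply, smul_eq_mul] at h ⊢
  rw [← h, Finset.mul_sum]
  simp only [mul_assoc]

lemma IsSigPoly.sub (h : IsSigPoly f q) (h' : IsSigPoly f r) : IsSigPoly f (q - r) := by
  simp only [IsSigPoly, Prod.fst_sub, Prod.snd_sub, Pi.sub_apply] at h h' ⊢
  rw [← h, ← h', ← Finset.sum_sub_distrib]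
  simp only [sub_mul]

lemma IsSigPoly.fst_ne_zero (h : IsSigPoly f q) (h0 : q.2 ≠ 0) : q.1 ≠ 0 := by
  intro e
  apply h0
  rw [← h]
  simp [e]

lemma isSigPoly_unitSig (i : Fin d) : IsSigPoly f (unitSig f i) := by
  simp [IsSigPoly, unitSig, Pi.single_apply]

lemma isSigPoly_principalSyz (h : IsSigPoly f q) (h' : IsSigPoly f r) :
    IsSigPoly f (principalSyz q r) := by
  simp only [IsSigPoly, principalSyz, Pi.sub_apply, Pi.smul_apply, smul_eq_mul] at h h' ⊢
  simp only [sub_mul, Finset.sum_sub_distrib, mul_assoc, ← Finset.mul_sum]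
  rw [h, h']
  ring

lemma isSig_unitSig (so : ModuleOrder n d) (i : Fin d) : IsSig so (unitSig f i) ⟨i, 0⟩ := by
  classical
  refine ⟨by simp [unitSig], fun t ht => ?_⟩
  rcases t with ⟨j, m⟩
  simp only [unitSig, Pi.single_apply, mem_support_iff] at ht
  split_ifs at ht with h
  · subst h
    rw [MvPolynomial.coeff_one] at ht
    have : m = 0 := by
      by_contra h
      simp [Ne.symm h] at ht
    subst this
    exact so.le_refl _
  · simp at ht

end IsSigPoly

/-! ### Positions in lists. -/

section Lists
variable {α : Type*} {L : List α}

lemma exists_last_split {p : α → Prop} (h : ∃ q ∈ L, p q) :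
    ∃ A q B, L = A ++ q :: B ∧ p q ∧ ∀ r ∈ B, ¬ p r := by
  induction L with
  | nil => simp at h
  | cons x L ih =>
    by_cases h' : ∃ q ∈ L, p q
    · obtain ⟨A, q, B, rfl, h1, h2⟩ := ih h'
      exact ⟨x :: A, q, B, rfl, h1, h2⟩
    · obtain ⟨q, hq, hp⟩ := h
      rcases List.mem_cons.1 hq with rfl | hq
      · exact ⟨[], q, L, rfl, hp, fun r hr hr' => h' ⟨r, hr, hr'⟩⟩
      · exact absurd ⟨q, hq, hp⟩ h'

/-- The relation "`r` comes after `a`" is expressed by sublists because these survive later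
insertions. In a list without repetition the `a` of the sublist must be the displayed one. -/
lemma mem_of_pair_sublist {A B : List α} {a r : α} (hn : (A ++ a :: B).Nodup)
    (h : [a, r].Sublist (A ++ a :: B)) : r ∈ B := by
  induction A with
  | nil =>
    rw [List.nil_append] at h hn
    rcases List.sublist_cons_iff.1 h with h | ⟨r', e, h⟩
    · exact absurd (h.subset (by simp)) (List.nodup_cons.1 hn).1
    · obtain rfl := (List.cons.inj e).2
      exact h.subset (by simp)
  | cons x A ih =>
    rw [List.cons_append] at h hn
    rcases List.sublist_cons_iff.1 h with h | ⟨r', e, h⟩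
    · exact ih (List.nodup_cons.1 hn).2 h
    · have := (List.cons.inj e).1
      subst this
      exact absurd (by simp) (List.nodup_cons.1 hn).1

lemma pair_sublist_or {a b : α} (ha : a ∈ L) (hb : b ∈ L) (hab : a ≠ b) :
    [a, b].Sublist L ∨ [b, a].Sublist L := by
  obtain ⟨A, B, rfl⟩ := List.append_of_mem ha
  rcases List.mem_append.1 hb with h | h
  · right
    exact (List.singleton_sublist.2 h).append (List.singleton_sublist.2 (by simp) : [a].Sublist (a :: B))
  · left
    have hB : b ∈ B := (List.mem_cons.1 h).resolve_left hab.symm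
    exact ((List.singleton_sublist.2 hB).cons_cons a).trans (List.sublist_append_right _ _)

end Lists

/-! ### Correctness: covered J-pairs imply a Gröbner basis. -/

section Coverage
variable {k : Type*} [Field k] {n d : ℕ} {ord : MonomialOrder (Fin n)} {so : ModuleOrder n d}
  {f : Fin d → MvPolynomial (Fin n) k} {SG : List (SigPoly k n d)}

/-- The signature `S` is a multiple of the signature of a syzygy. -/
def SyzDvd (so : ModuleOrder n d) (f : Fin d → MvPolynomial (Fin n) k) (S : ModMon n d) : Prop :=
  ∃ z, IsSigPoly f z ∧ z.2 = 0 ∧ ∃ s t, IsSig so z s ∧ s.shift t = S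

/-- A multiple of `a` with signature `S` need not be considered: a later element of the list, or
a syzygy, has a signature that divides `S`. -/
def Covered (so : ModuleOrder n d) (f : Fin d → MvPolynomial (Fin n) k)
    (SG : List (SigPoly k n d)) (a : SigPoly k n d) (S : ModMon n d) : Prop :=
  (∃ r, [a, r].Sublist SG ∧ ∃ s t, IsSig so r s ∧ s.shift t = S) ∨ SyzDvd so f S

lemma SyzDvd.shift {S : ModMon n d} (h : SyzDvd so f S) (t : Fin n →₀ ℕ) :
    SyzDvd so f (S.shift t) := by
  obtain ⟨z, h1, h2, s, t', h3, rfl⟩ := h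
  exact ⟨z, h1, h2, s, t + t', h3, (ModMon.shift_shift _ _ _).symm⟩

/-- Either there is a syzygy of signature `T`, or a multiple of an element
of the list attains the least leading monomial among all sig-polynomials of signature `T`. -/
def AttainsMin (ord : MonomialOrder (Fin n)) (so : ModuleOrder n d)
    (f : Fin d → MvPolynomial (Fin n) k) (SG : List (SigPoly k n d)) (T : ModMon n d) : Prop :=
  SyzDvd so f T ∨ ∃ q ∈ SG, q.2 ≠ 0 ∧ IsSigPoly f q ∧ ∃ s t, IsSig so q s ∧ s.shift t = T ∧
    ∀ r, IsSigPoly f r → r.2 ≠ 0 → IsSig so r T →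
      ord.toSyn (t + ord.degree q.2) ≤ ord.toSyn (ord.degree r.2)

/-- Well-founded descent on the signature: unless a minimal multiple already has the leading
monomial of `w`, subtracting a sig-polynomial of signature `T` lowers the signature and keeps the
leading monomial. -/
lemma exists_reducer_of_attainsMin (T : ModMon n d)
    (hT : ∀ T', so.le T' T → AttainsMin ord so f SG T') (w : SigPoly k n d)
    (hw : IsSigPoly f w) (hw0 : w.2 ≠ 0) (hs : IsSig so w T) :
    ∃ q ∈ SG, q.2 ≠ 0 ∧ ∃ s t, IsSig so q s ∧ t + ord.degree q.2 = ord.degree w.2 ∧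
      so.le (s.shift t) T := by
  induction T using so.wellFounded_lt.induction generalizing w with
  | _ T ih =>
  have key : ∀ w' : SigPoly k n d, IsSigPoly f w' → w'.2 ≠ 0 →
      ord.degree w'.2 = ord.degree w.2 → SigLT so w' T →
      ∃ q ∈ SG, q.2 ≠ 0 ∧ ∃ s t, IsSig so q s ∧ t + ord.degree q.2 = ord.degree w.2 ∧
      so.le (s.shift t) T := by
    intro w' h1 h2 h3 h4
    obtain ⟨s', hs'⟩ := exists_isSig so (h1.fst_ne_zero h2)
    have hlt := h4.lt hs'
    obtain ⟨q, hq, hq0, s, t, h5, h6, h7⟩ :=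
      ih s' hlt (fun T' hT' => hT T' (so.le_trans _ _ _ hT' hlt.1)) w' h1 h2 hs'
    exact ⟨q, hq, hq0, s, t, h5, h6.trans h3, so.le_trans _ _ _ h7 hlt.1⟩
  rcases hT T (so.le_refl T) with ⟨z, hz, hz0, s, t, h1, h2⟩ | ⟨q, hq, hq0, hqs, s, t, h1, h2, h3⟩
  -- Subtracting a multiple of a syzygy does not change the polynomial part.
  · have h4 := h1.monomial_smul t (one_ne_zero (α := k))
    rw [h2] at h4
    obtain ⟨c, hc, h5⟩ := hs.exists_sigLT_sub h4
    refine key _ (hw.sub ((hz.smul _).smul _)) ?_ ?_ h5 <;> simp [hz0, hw0]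
  · rcases (h3 w hw hw0 hs).lt_or_eq with hlt | heq
    · have h4 := h1.monomial_smul t (one_ne_zero (α := k))
      rw [h2] at h4
      obtain ⟨c, hc, h5⟩ := hs.exists_sigLT_sub h4
      have h6 := degree_sub_eq_of_lt ord (p := w.2) (q := monomial 0 c * (monomial t 1 * q.2))
        (by rw [degree_monomial_mul ord (mul_ne_zero (by simp) hq0) _ hc,
              degree_monomial_mul ord hq0 _ one_ne_zero, zero_add]; exact hlt)
      exact key _ (hw.sub ((hqs.smul _).smul _)) h6.1 h6.2 h5
    · exact ⟨q, hq, hq0, s, t, h1, ord.toSyn.injective heq, h2 ▸ so.le_refl _⟩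

/-- A tm-reducible multiple of `a` is a multiple of a J-pair with first component `a`. -/
lemma isFirst_of_add_eq {a b : SigPoly k n d} (ha : a.2 ≠ 0) (hb : b.2 ≠ 0) {s s' : ModMon n d}
    (hs : IsSig so a s) (hs' : IsSig so b s') {t t' : Fin n →₀ ℕ}
    (h : t + ord.degree a.2 = t' + ord.degree b.2) (hlt : so.lt (s'.shift t') (s.shift t)) :
    IsFirst ord so a b ∧ ∃ v, t = v + multiplier ord a b := by
  set m := ord.degree a.2 ⊔ ord.degree b.2 with hm
  have hle : m ≤ t + ord.degree a.2 := sup_le le_add_self (h ▸ le_add_self)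
  obtain ⟨v, hv⟩ := exists_add_of_le hle
  have h1 : t = v + multiplier ord a b := by
    have : multiplier ord a b + ord.degree a.2 = m := tsub_add_cancel_of_le le_sup_left
    rw [← this] at hv
    apply add_right_cancel (b := ord.degree a.2)
    rw [hv]
    abel
  have h2 : t' = v + multiplier ord b a := by
    have : multiplier ord b a + ord.degree b.2 = m := by
      rw [hm, sup_comm]
      exact tsub_add_cancel_of_le le_sup_left
    rw [h, ← this] at hv
    apply add_right_cancel (b := ord.degree b.2)
    rw [hv]
    abel
  refine ⟨⟨ha, hb, s, s', hs, hs', ?_⟩, v, h1⟩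
  apply ModuleOrder.lt_of_shift_lt v
  rw [ModMon.shift_shift, ModMon.shift_shift, ← h1, ← h2]
  exact hlt

/-- The last list element whose signature divides `T` must give the minimum: otherwise its multiple
is tm-reducible, and coverage of the resulting J-pair produces a still later divisor or a syzygy. -/
lemma attainsMin_of_covered (hn : SG.Nodup) (hunit : ∀ i, unitSig f i ∈ SG)
    (hsp : ∀ q ∈ SG, IsSigPoly f q)
    (hcov : ∀ a ∈ SG, ∀ b ∈ SG, ∀ s, IsFirst ord so a b → IsSig so a s →
      Covered so f SG a (s.shift (multiplier ord a b))) (T : ModMon n d) :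
    AttainsMin ord so f SG T := by
  induction T using so.wellFounded_lt.induction with
  | _ T ih =>
  by_cases hz : SyzDvd so f T
  · exact .inl hz
  refine .inr ?_
  obtain ⟨A, q, B, hSG, ⟨s, t, hqs, hst⟩, hB⟩ :=
    exists_last_split (L := SG) (p := fun q => ∃ s t, IsSig so q s ∧ s.shift t = T)
      ⟨_, hunit T.idx, ⟨T.idx, 0⟩, T.mon, isSig_unitSig so _, by simp [ModMon.shift]⟩
  have hq : q ∈ SG := by simp [hSG]
  have hq0 : q.2 ≠ 0 := fun h => hz ⟨q, hsp q hq, h, s, t, hqs, hst⟩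
  refine ⟨q, hq, hq0, hsp q hq, s, t, hqs, hst, fun r hr hr0 hrs => ?_⟩
  by_contra hlt
  rw [not_le] at hlt
  have h4 := hqs.monomial_smul t (one_ne_zero (α := k))
  rw [hst] at h4
  -- Subtracting the smaller competitor `r` keeps the leading monomial of the multiple of `q` but
  -- lowers the signature, so the induction hypothesis supplies a reducer `q'`.
  obtain ⟨c, hc, h5⟩ := h4.exists_sigLT_sub hrs
  have h6 := degree_sub_eq_of_lt ord (p := monomial t 1 * q.2) (q := monomial 0 c * r.2)
        (by rw [degree_monomial_mul ord hr0 _ hc,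
              degree_monomial_mul ord hq0 _ one_ne_zero, zero_add]; exact hlt)
  have h7 := ((hsp q hq).smul (monomial t (1 : k))).sub (hr.smul (monomial 0 c))
  obtain ⟨s', hs'⟩ := exists_isSig so (h7.fst_ne_zero h6.1)
  have hs'T := h5.lt hs'
  obtain ⟨q', hq', hq'0, s'', t', h8, h9, h10⟩ := exists_reducer_of_attainsMin s'
    (fun T' hT' => ih T' (ModuleOrder.lt_of_le_of_lt hT' hs'T)) _ h7 h6.1 hs'
  replace h9 := h9.trans h6.2
  rw [degree_monomial_mul ord hq0 _ one_ne_zero] at h9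
  obtain ⟨hfirst, v, hv⟩ := isFirst_of_add_eq hq0 hq'0 hqs h8 h9.symm
    (hst ▸ ModuleOrder.lt_of_le_of_lt h10 hs'T)
  have hT : (s.shift (multiplier ord q q')).shift v = T := by
    rw [ModMon.shift_shift, ← hv, hst]
  rcases hcov q hq q' hq' s hfirst hqs with ⟨r', h11, s₁, t₁, h12, h13⟩ | h11
  -- A divisor of the signature of the J-pair also divides `T`, so `r'` would be a divisor coming
  -- after the last one.
  · rw [hSG] at h11 hn
    refine hB r' (mem_of_pair_sublist hn h11) ⟨s₁, v + t₁, h12, ?_⟩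
    rw [← ModMon.shift_shift, h13, hT]
  · exact hz (hT ▸ h11.shift v)

lemma exists_degree_le_of_covered (hn : SG.Nodup) (hunit : ∀ i, unitSig f i ∈ SG)
    (hsp : ∀ q ∈ SG, IsSigPoly f q)
    (hcov : ∀ a ∈ SG, ∀ b ∈ SG, ∀ s, IsFirst ord so a b → IsSig so a s →
      Covered so f SG a (s.shift (multiplier ord a b)))
    {p : MvPolynomial (Fin n) k} (hp : p ∈ Ideal.span (Set.range f)) (hp0 : p ≠ 0) :
    ∃ q ∈ SG, q.2 ≠ 0 ∧ ord.degree q.2 ≤ ord.degree p := by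
  obtain ⟨c, hc⟩ := Ideal.mem_span_range_iff_exists_fun.1 hp
  have hw : IsSigPoly f (c, p) := hc
  obtain ⟨s, hs⟩ := exists_isSig so (hw.fst_ne_zero hp0)
  obtain ⟨q, hq, hq0, s', t, -, h, -⟩ := exists_reducer_of_attainsMin s
    (fun T _ => attainsMin_of_covered hn hunit hsp hcov T) _ hw hp0 hs
  exact ⟨q, hq, hq0, h ▸ le_add_self⟩

end Coverage

/-! ### Invariants of a run. -/

section Invariant
variable {k : Type*} [Field k] {n d : ℕ} {ord : MonomialOrder (Fin n)} {so : ModuleOrder n d}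
  {f : Fin d → MvPolynomial (Fin n) k} {SG SG' : List (SigPoly k n d)}
  {P P' : Finset (SigPoly k n d)} {C : Finset (CritPair k n d)} {cp : CritPair k n d}
  {sp sp' q r : SigPoly k n d}

/-- The signature of `q` is smaller than that of `r`. -/
def SigLess (so : ModuleOrder n d) (q r : SigPoly k n d) : Prop :=
  ∃ s s', IsSig so q s ∧ IsSig so r s' ∧ so.lt s s'

/-- `c` is the J-pair of two elements of the list `SG`. -/
def IsPairOf (ord : MonomialOrder (Fin n)) (so : ModuleOrder n d) (SG : List (SigPoly k n d))
    (c : CritPair k n d) : Prop :=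
  c.first ∈ SG ∧ ∃ b ∈ SG, IsFirst ord so c.first b ∧ c.mult = multiplier ord c.first b

/-- The polynomial part is homogeneous, of the g-weighted degree of the signature. -/
def Homogeneous (ord : MonomialOrder (Fin n)) (so : ModuleOrder n d)
    (f : Fin d → MvPolynomial (Fin n) k) (q : SigPoly k n d) : Prop :=
  ∀ s, IsSig so q s → q.2.IsHomogeneous (gwDeg ord f s)

lemma IsFirst.irrefl (h : IsFirst ord so q q) : False := by
  obtain ⟨-, -, s, s', hs, hs', h⟩ := h
  rw [hs.unique hs'] at h
  exact ModuleOrder.lt_irrefl _ h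

lemma IsFirst.asymm (h : IsFirst ord so q r) (h' : IsFirst ord so r q) : False := by
  obtain ⟨-, -, s, s', hs, hs', h⟩ := h
  obtain ⟨-, -, t, t', ht, ht', h'⟩ := h'
  rw [hs.unique ht', hs'.unique ht] at h
  exact ModuleOrder.lt_irrefl _ (ModuleOrder.lt_trans h h')

lemma SigLess.trans {a b c : SigPoly k n d} (h : SigLess so a b) (h' : SigLess so b c) :
    SigLess so a c := by
  obtain ⟨s, s', hs, hs', h⟩ := h
  obtain ⟨t, t', ht, ht', h'⟩ := h'
  exact ⟨s, t', hs, ht', ModuleOrder.lt_trans h (hs'.unique ht ▸ h')⟩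

lemma SigLess.not_same {a b : SigPoly k n d} (h : SigLess so a b) {s : ModMon n d}
    (ha : IsSig so a s) (hb : IsSig so b s) : False := by
  obtain ⟨s, s', hs, hs', h⟩ := h
  rw [hs.unique ha, hs'.unique hb] at h
  exact ModuleOrder.lt_irrefl _ h

lemma CritPair.isSig_toSigPoly {s : ModMon n d} (h : IsSig so cp.first s) :
    IsSig so cp.toSigPoly (s.shift cp.mult) := h.monomial_smul _ one_ne_zero

lemma Covered.mono {a : SigPoly k n d} {S : ModMon n d} (h : Covered so f SG a S)
    (hl : SG.Sublist SG') : Covered so f SG' a S := by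
  rcases h with ⟨r, h1, h2⟩ | h
  · exact .inl ⟨r, h1.trans hl, h2⟩
  · exact .inr h

lemma IsFirst.exists_isSig (h : IsFirst ord so q r) : ∃ s, IsSig so q s := by
  obtain ⟨-, -, s, s', hs, -⟩ := h
  exact ⟨s, hs⟩

lemma IsPairOf.snd_ne_zero (h : IsPairOf ord so SG cp) : cp.first.2 ≠ 0 := by
  obtain ⟨-, b, -, h, -⟩ := h
  exact h.1

lemma IsPairOf.exists_isSig (h : IsPairOf ord so SG cp) :
    ∃ s, IsSig so cp.first s ∧ IsSig so cp.toSigPoly (s.shift cp.mult) := by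
  obtain ⟨-, b, -, h, -⟩ := h
  obtain ⟨s, hs⟩ := h.exists_isSig
  exact ⟨s, hs, CritPair.isSig_toSigPoly hs⟩

lemma IsPairOf.mono (h : IsPairOf ord so SG cp) (hs : SG ⊆ SG') : IsPairOf ord so SG' cp := by
  obtain ⟨h1, b, hb, h⟩ := h
  exact ⟨hs h1, b, hs hb, h⟩

lemma IsPairOf.toSigPoly_snd_ne_zero (h : IsPairOf ord so SG cp) : cp.toSigPoly.2 ≠ 0 :=
  mul_ne_zero (by simp) h.snd_ne_zero

lemma IsPairOf.degree_toSigPoly (h : IsPairOf ord so SG cp) :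
    ord.degree cp.toSigPoly.2 = cp.mult + ord.degree cp.first.2 :=
  degree_monomial_mul ord h.snd_ne_zero _ one_ne_zero

/-- A J-pair is tm-reducible by its second component. -/
lemma IsPairOf.exists_tmStep (h : IsPairOf ord so SG cp) :
    ∃ sp', TmStep ord so SG cp.toSigPoly sp' := by
  obtain ⟨-, b, hb, ⟨h1, h2, s, s', hs, hs', hlt⟩, hm⟩ := id h
  refine ⟨_, b, hb, multiplier ord b cp.first, ⟨h2, h.toSigPoly_snd_ne_zero, ?_, s', _, hs',
    CritPair.isSig_toSigPoly hs, hm ▸ hlt⟩, rfl⟩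
  rw [h.degree_toSigPoly, hm, multiplier, multiplier, sup_comm,
    tsub_add_cancel_of_le le_sup_left, sup_comm, tsub_add_cancel_of_le le_sup_left]

/-- The second component is not recorded, so a J-pair is determined by its first component and its
signature. -/
lemma CritPair.eq_of_first_eq {c c' : CritPair k n d} (h : c.first = c'.first) {s T : ModMon n d}
    (hs : IsSig so c.first s) (hT : IsSig so c.toSigPoly T) (hT' : IsSig so c'.toSigPoly T) :
    c = c' := by
  have h1 := hT.unique (CritPair.isSig_toSigPoly hs)
  have h2 := hT'.unique (CritPair.isSig_toSigPoly (h ▸ hs))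
  have h3 := congrArg ModMon.mon (h1.symm.trans h2)
  rcases c with ⟨m, a⟩
  rcases c' with ⟨m', a'⟩
  obtain rfl : a = a' := h
  obtain rfl : m = m' := add_right_cancel h3
  rfl

lemma degree_degree_of_isHomogeneous {p : MvPolynomial (Fin n) k} {e : ℕ}
    (h : p.IsHomogeneous e) (hp : p ≠ 0) : (ord.degree p).degree = e := by
  have := h (ord.coeff_degree_ne_zero_iff.2 hp)
  rwa [Finsupp.degree_eq_weight_one]

lemma Homogeneous.monomial_smul (h : Homogeneous ord so f q) {s : ModMon n d}
    (hs : IsSig so q s) (t : Fin n →₀ ℕ) {c : k} (hc : c ≠ 0) :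
    Homogeneous ord so f ((monomial t c : MvPolynomial (Fin n) k) • q) := by
  intro s' hs'
  rw [hs'.unique (hs.monomial_smul t hc)]
  have := (isHomogeneous_monomial (d := t) c rfl).mul (h s hs)
  rwa [show gwDeg ord f (s.shift t) = t.degree + gwDeg ord f s by simp [gwDeg, add_assoc]]

lemma TmStep.isSig (h : TmStep ord so SG sp sp') {T : ModMon n d} (hT : IsSig so sp T) :
    IsSig so sp' T := by
  obtain ⟨q, -, t, ⟨hq, hr, -, s, s', hs, hs', hlt⟩, rfl⟩ := h
  rw [hs'.unique hT] at hlt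
  exact hT.sub ((hs.monomial_smul t (div_ne_zero (ord.leadingCoeff_ne_zero_iff.2 hr)
    (ord.leadingCoeff_ne_zero_iff.2 hq))).sigLT hlt)

lemma TmStep.isSigPoly (h : TmStep ord so SG sp sp') (hSG : ∀ q ∈ SG, IsSigPoly f q)
    (hsp : IsSigPoly f sp) : IsSigPoly f sp' := by
  obtain ⟨q, hq, t, -, rfl⟩ := h
  exact hsp.sub ((hSG q hq).smul _)

lemma TmStep.degree_lt (h : TmStep ord so SG sp sp') :
    sp.2 ≠ 0 ∧ (sp'.2 ≠ 0 → ord.toSyn (ord.degree sp'.2) < ord.toSyn (ord.degree sp.2)) := by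
  obtain ⟨q, -, t, ⟨hq, hr, ht, -⟩, rfl⟩ := h
  exact ⟨hr, fun h0 => degree_sub_monomial_mul_lt ord hr hq ht h0⟩

lemma TmStep.homogeneous (h : TmStep ord so SG sp sp')
    (hSG : ∀ q ∈ SG, Homogeneous ord so f q) (hsp : Homogeneous ord so f sp) :
    Homogeneous ord so f sp' := by
  intro s hs
  obtain ⟨q, hq, t, ⟨hq0, hr, ht, s₁, s₂, hs₁, hs₂, hlt⟩, rfl⟩ := id h
  obtain rfl := hs.unique (h.isSig hs₂)
  have h1 := hsp _ hs₂
  refine h1.sub ?_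
  have hqh := hSG q hq _ hs₁
  have h2 := (isHomogeneous_monomial (d := t) (ord.leadingCoeff sp.2 / ord.leadingCoeff q.2)
    rfl).mul hqh
  -- Both sides are the degree of the leading monomial that `sp` shares with the multiple of the
  -- reducer.
  have e : gwDeg ord f s = t.degree + gwDeg ord f s₁ := by
    rw [← degree_degree_of_isHomogeneous (ord := ord) h1 hr,
      ← degree_degree_of_isHomogeneous (ord := ord) hqh hq0, ← ht, map_add]
  rwa [e]

lemma homogeneous_unitSig (hf : ∀ i, ∃ e, (f i).IsHomogeneous e) (i : Fin d) :
    Homogeneous ord so f (unitSig f i) := by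
  intro s hs
  rw [hs.unique (isSig_unitSig so i)]
  obtain ⟨e, he⟩ := hf i
  by_cases h0 : f i = 0
  · simp only [unitSig, h0]
    exact isHomogeneous_zero _ _ _
  · have := degree_degree_of_isHomogeneous (ord := ord) he h0
    simpa [gwDeg, unitSig, this] using he

/-- What holds throughout a run of the algorithm. -/
structure BaseInv (ord : MonomialOrder (Fin n)) (so : ModuleOrder n d)
    (f : Fin d → MvPolynomial (Fin n) k) (SG : List (SigPoly k n d))
    (P : Finset (SigPoly k n d)) (C : Finset (CritPair k n d)) : Prop where
  nodup : SG.Nodup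
  unit : ∀ i, unitSig f i ∈ SG
  sigPoly : ∀ q ∈ SG, IsSigPoly f q
  ne_zero : ∀ q ∈ SG, q.1 ≠ 0
  homog : (∀ i, ∃ e, (f i).IsHomogeneous e) → ∀ q ∈ SG, Homogeneous ord so f q
  syz : ∀ z ∈ P, IsSigPoly f z ∧ z.2 = 0 ∧ z.1 ≠ 0
  pair : ∀ c ∈ C, IsPairOf ord so SG c
  uniq : ∀ c ∈ C, ∀ c' ∈ C, SameSig so c.toSigPoly c'.toSigPoly → c = c'

/-- The invariant at the head of the while-loop. -/
structure LoopInv (ord : MonomialOrder (Fin n)) (so : ModuleOrder n d)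
    (f : Fin d → MvPolynomial (Fin n) k) (SG : List (SigPoly k n d))
    (P : Finset (SigPoly k n d)) (C : Finset (CritPair k n d)) : Prop
    extends BaseInv ord so f SG P C where
  less : ∀ q ∈ SG, (∃ i, q = unitSig f i) ∨ ∀ c ∈ C, SigLess so q c.toSigPoly
  cov : ∀ a ∈ SG, ∀ b ∈ SG, ∀ s, IsFirst ord so a b → IsSig so a s →
    ⟨multiplier ord a b, a⟩ ∈ C ∨ Covered so f SG a (s.shift (multiplier ord a b))

/-- The invariant during the tm-reduction of a J-pair. -/
structure ReducingInv (ord : MonomialOrder (Fin n)) (so : ModuleOrder n d)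
    (f : Fin d → MvPolynomial (Fin n) k) (SG : List (SigPoly k n d))
    (P : Finset (SigPoly k n d)) (C : Finset (CritPair k n d)) (cp : CritPair k n d)
    (sp : SigPoly k n d) : Prop
    extends BaseInv ord so f SG P C where
  isPair : IsPairOf ord so SG cp
  notRewritable : ¬ F5Rewritable so SG cp
  less : ∀ q ∈ SG, (∃ i, q = unitSig f i) ∨ SigLess so q cp.toSigPoly
  pairs_gt : ∀ c ∈ C, SigLess so cp.toSigPoly c.toSigPoly
  cov : ∀ a ∈ SG, ∀ b ∈ SG, ∀ s, IsFirst ord so a b → IsSig so a s →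
    ⟨multiplier ord a b, a⟩ = cp ∨ ⟨multiplier ord a b, a⟩ ∈ C ∨
      Covered so f SG a (s.shift (multiplier ord a b))
  sp_sigPoly : IsSigPoly f sp
  sp_sig : ∀ T, IsSig so cp.toSigPoly T → IsSig so sp T
  sp_homog : (∀ i, ∃ e, (f i).IsHomogeneous e) → Homogeneous ord so f sp
  sp_degree : sp = cp.toSigPoly ∨
    (sp.2 ≠ 0 → ord.toSyn (ord.degree sp.2) < ord.toSyn (ord.degree cp.toSigPoly.2))

lemma BaseInv.subset (h : BaseInv ord so f SG P C) {C' : Finset (CritPair k n d)}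
    (hC : C' ⊆ C) : BaseInv ord so f SG P C' :=
  { h with
    pair := fun c hc => h.pair c (hC hc)
    uniq := fun c hc c' hc' => h.uniq c (hC hc) c' (hC hc') }

/-- Elements of `P` are syzygies. In the F5-rewritable case the blocking element comes after
`cp.first`: since the signature of `cp.first` divides that of `cp`, it cannot lie behind the last
divisor. -/
lemma Rejected.covered (h : Rejected ord so SG P cp) (hI : BaseInv ord so f SG P C)
    (hcp : cp.first ∈ SG) {s : ModMon n d} (hs : IsSig so cp.first s) :
    Covered so f SG cp.first (s.shift cp.mult) := by
  have hT := CritPair.isSig_toSigPoly hs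
  rcases h with ⟨z, hz, -, s', t, hs', ht, -⟩ | ⟨A, q, B, rfl, ⟨s', t, hs', ht⟩, hB, hne⟩
  · obtain ⟨h1, h2, h3⟩ := hI.syz z hz
    exact .inr ⟨z, h1, h2, s', t, hs', ht.unique hT⟩
  · refine .inl ⟨q, ?_, s', t, hs', ht.unique hT⟩
    rcases List.mem_append.1 hcp with h | h
    · exact (List.singleton_sublist.2 h).append
        (List.singleton_sublist.2 (by simp) : [q].Sublist (q :: B))
    · exact absurd ⟨s, cp.mult, hs, hT⟩ (hB _ ((List.mem_cons.1 h).resolve_left hne.symm))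

open Classical in
lemma LoopInv.reject (h : LoopInv ord so f SG P C) (hrej : Rejected ord so SG P cp)
    (hmem : cp ∈ C) : LoopInv ord so f SG P (C.erase cp) :=
  { h.toBaseInv.subset (Finset.erase_subset cp C) with
    less := fun q hq => (h.less q hq).imp_right fun h c hc => h c (Finset.mem_of_mem_erase hc)
    cov := fun a ha b hb s hab hs => by
      rcases h.cov a ha b hb s hab hs with h1 | h1
      · by_cases e : (⟨multiplier ord a b, a⟩ : CritPair k n d) = cp
        · subst e
          exact .inr (hrej.covered h.toBaseInv ha hs)
        · exact .inl (Finset.mem_erase.2 ⟨e, h1⟩)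
      · exact .inr h1 }

lemma IsSigPoly.toSigPoly (h : IsSigPoly f cp.first) : IsSigPoly f cp.toSigPoly := h.smul _

open Classical in
lemma LoopInv.select (h : LoopInv ord so f SG P C) (hmin : IsMinPair so C cp)
    (hrej : ¬ Rejected ord so SG P cp) :
    ReducingInv ord so f SG P (C.erase cp) cp cp.toSigPoly :=
  have hp := h.pair cp hmin.1
  { h.toBaseInv.subset (Finset.erase_subset cp C) with
    isPair := hp
    notRewritable := fun h => hrej (.inr h)
    less := fun q hq => (h.less q hq).imp_right fun h => h cp hmin.1
    pairs_gt := fun c hc => by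
      obtain ⟨hne, hc⟩ := Finset.mem_erase.1 hc
      obtain ⟨s, s', hs, hs', hle⟩ := hmin.2 c hc
      -- Equality is impossible because pending J-pairs have distinct signatures.
      rcases ModuleOrder.lt_or_eq_of_le hle with hlt | rfl
      · exact ⟨s, s', hs, hs', hlt⟩
      · exact absurd (h.uniq c hc cp hmin.1 ⟨s, hs', hs⟩) hne
    cov := fun a ha b hb s hab hs => by
      rcases h.cov a ha b hb s hab hs with h1 | h1
      · by_cases e : (⟨multiplier ord a b, a⟩ : CritPair k n d) = cp
        · exact .inl e
        · exact .inr (.inl (Finset.mem_erase.2 ⟨e, h1⟩))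
      · exact .inr (.inr h1)
    sp_sigPoly := (h.sigPoly _ hp.1).toSigPoly
    sp_sig := fun T hT => hT
    sp_homog := fun hf => by
      obtain ⟨s, hs, -⟩ := hp.exists_isSig
      exact (h.homog hf _ hp.1).monomial_smul hs _ one_ne_zero
    sp_degree := .inl rfl }

lemma ReducingInv.tmReduce (h : ReducingInv ord so f SG P C cp sp)
    (hstep : TmStep ord so SG sp sp') : ReducingInv ord so f SG P C cp sp' :=
  { h with
    sp_sigPoly := hstep.isSigPoly h.sigPoly h.sp_sigPoly
    sp_sig := fun T hT => hstep.isSig (h.sp_sig T hT)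
    sp_homog := fun hf => hstep.homogeneous (h.homog hf) (h.sp_homog hf)
    sp_degree := .inr fun h0 => by
      have h1 := hstep.degree_lt
      rcases h.sp_degree with e | h2
      · rw [← e]
        exact h1.2 h0
      · exact (h1.2 h0).trans (h2 h1.1) }

/-- The result of a tm-reduction is new. -/
lemma ReducingInv.notMem (h : ReducingInv ord so f SG P C cp sp)
    (hirr : ∀ sp', ¬ TmStep ord so SG sp sp') : sp ∉ SG := by
  intro hmem
  obtain ⟨s, hs, hT⟩ := h.isPair.exists_isSig
  have hsp := h.sp_sig _ hT
  -- All list elements except the initial ones have signatures below that of `cp`. If `sp` is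
  -- initial, its signature is a unit vector, which forces the multiplier of `cp` to be trivial.
  rcases h.less sp hmem with ⟨i, rfl⟩ | hless
  · have e := hsp.unique (isSig_unitSig so i)
    have hm : cp.mult + s.mon = 0 := congrArg ModMon.mon e
    have hm0 : cp.mult = 0 := by
      rw [add_eq_zero] at hm
      exact hm.1
    rw [hm0, ModMon.shift_zero] at e
    rcases h.less cp.first h.isPair.1 with ⟨j, hj⟩ | hless
    · have e' := hs.unique (hj ▸ isSig_unitSig so j)
      obtain rfl : i = j := congrArg ModMon.idx (e.symm.trans e')
      have hcp : cp.toSigPoly = unitSig f i := by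
        rw [CritPair.toSigPoly, hm0, hj]
        exact one_smul _ _
      -- Now `cp` equals `sp`. A J-pair is tm-reducible, whereas `sp` is not; and `sp` cannot have a
      -- leading monomial below its own.
      rcases h.sp_degree with _ | h1
      · obtain ⟨sp', h2⟩ := h.isPair.exists_tmStep
        exact hirr sp' (hcp ▸ h2)
      · rw [hcp] at h1
        exact (h1 (hj ▸ h.isPair.snd_ne_zero)).false
    · rw [hm0, ModMon.shift_zero] at hT
      exact hless.not_same hs hT
  · exact hless.not_same hsp hT

lemma InsertF5GEN.sublist (h : InsertF5GEN so sp cp SG SG') : SG.Sublist SG' := by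
  obtain ⟨A, B, rfl, rfl, -⟩ := h
  exact (List.Sublist.refl A).append (List.sublist_cons_self sp B)

lemma InsertF5GEN.mem_iff (h : InsertF5GEN so sp cp SG SG') : q ∈ SG' ↔ q = sp ∨ q ∈ SG := by
  obtain ⟨A, B, rfl, rfl, -⟩ := h
  simp only [List.mem_append, List.mem_cons]
  tauto

lemma InsertF5GEN.pair_sublist (h : InsertF5GEN so sp cp SG SG') : [cp.first, sp].Sublist SG' := by
  obtain ⟨A, B, rfl, rfl, hA, -⟩ := h
  exact (List.singleton_sublist.2 hA).append
    (List.singleton_sublist.2 (by simp) : [sp].Sublist (sp :: B))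

/-- The part common to both kinds of insertion. The treated J-pair becomes covered by `sp`, which
has the same signature and is placed after the first component. -/
lemma ReducingInv.insert (h : ReducingInv ord so f SG P C cp sp)
    (hirr : ∀ sp', ¬ TmStep ord so SG sp sp') (hins : InsertF5GEN so sp cp SG SG') :
    BaseInv ord so f SG' P C ∧
    (∀ q ∈ SG', (∃ i, q = unitSig f i) ∨ ∀ c ∈ C, SigLess so q c.toSigPoly) ∧
    ∀ a ∈ SG, ∀ b ∈ SG, ∀ s, IsFirst ord so a b → IsSig so a s →
      ⟨multiplier ord a b, a⟩ ∈ C ∨ Covered so f SG' a (s.shift (multiplier ord a b)) := by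
  obtain ⟨s₀, hs₀, hT⟩ := h.isPair.exists_isSig
  have hsp := h.sp_sig _ hT
  refine ⟨{ h.toBaseInv with
    nodup := ?_
    unit := fun i => hins.sublist.subset (h.unit i)
    sigPoly := ?_
    ne_zero := ?_
    homog := ?_
    pair := fun c hc => (h.pair c hc).mono hins.sublist.subset }, ?_, ?_⟩
  · have hn := h.notMem hirr
    obtain ⟨A, B, rfl, rfl, -⟩ := hins
    exact List.nodup_middle.2 (List.nodup_cons.2 ⟨hn, h.nodup⟩)
  · intro q hq
    rcases hins.mem_iff.1 hq with rfl | hq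
    exacts [h.sp_sigPoly, h.sigPoly q hq]
  · intro q hq
    rcases hins.mem_iff.1 hq with rfl | hq
    exacts [hsp.ne_zero, h.ne_zero q hq]
  · intro hf q hq
    rcases hins.mem_iff.1 hq with rfl | hq
    exacts [h.sp_homog hf, h.homog hf q hq]
  · intro q hq
    rcases hins.mem_iff.1 hq with rfl | hq
    · refine .inr fun c hc => ?_
      obtain ⟨s, s', hs, hs', hlt⟩ := h.pairs_gt c hc
      exact ⟨s, s', h.sp_sig s hs, hs', hlt⟩
    · exact (h.less q hq).imp_right fun h1 c hc => h1.trans (h.pairs_gt c hc)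
  · intro a ha b hb s hab hs
    rcases h.cov a ha b hb s hab hs with e | h1 | h1
    · subst e
      exact .inr (.inl ⟨sp, hins.pair_sublist, _, 0, hsp,
        by rw [ModMon.shift_zero, hs₀.unique hs]⟩)
    · exact .inl h1
    · exact .inr (h1.mono hins.sublist)

lemma ReducingInv.insertSyz (h : ReducingInv ord so f SG P C cp sp)
    (hirr : ∀ sp', ¬ TmStep ord so SG sp sp') (hins : InsertF5GEN so sp cp SG SG')
    (h0 : sp.2 = 0) : LoopInv ord so f SG' P C := by
  obtain ⟨h1, h2, h3⟩ := h.insert hirr hins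
  refine { h1 with less := h2, cov := fun a ha b hb s hab hs => ?_ }
  rcases hins.mem_iff.1 ha with rfl | ha
  · exact absurd h0 hab.1
  rcases hins.mem_iff.1 hb with rfl | hb
  · exact absurd h0 hab.2.1
  exact h3 a ha b hb s hab hs

lemma mem_jPair {a b : SigPoly k n d} {c : CritPair k n d} (h : c ∈ jPair ord so a b) :
    (IsFirst ord so a b ∧ c = ⟨multiplier ord a b, a⟩) ∨
    (IsFirst ord so b a ∧ c = ⟨multiplier ord b a, b⟩) := by
  unfold jPair at h
  split_ifs at h with h1 h2
  · exact .inl ⟨h1, by simpa using h⟩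
  · exact .inr ⟨h2, by simpa using h⟩
  · simp at h

lemma mem_jPair_left {a b : SigPoly k n d} (h : IsFirst ord so a b) :
    ⟨multiplier ord a b, a⟩ ∈ jPair ord so a b := by
  rw [jPair, if_pos h]
  simp

lemma mem_jPair_right {a b : SigPoly k n d} (h : IsFirst ord so b a) :
    ⟨multiplier ord b a, b⟩ ∈ jPair ord so a b := by
  rw [jPair, if_neg fun h' => h.asymm h', if_pos h]
  simp

lemma mem_newPairs {c : CritPair k n d} : c ∈ newPairs ord so SG sp ↔
    ∃ q ∈ SG, q.2 ≠ 0 ∧ q ≠ sp ∧ c ∈ jPair ord so sp q := by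
  classical
  simp only [newPairs, Finset.mem_biUnion, Finset.mem_filter, List.mem_toFinset]
  tauto

/-- The new J-pairs have signatures larger than that of the inserted element. -/
lemma sigLess_of_mem_newPairs (hirr : ∀ sp', ¬ TmStep ord so SG sp sp')
    (hmem : ∀ q ∈ SG', q = sp ∨ q ∈ SG) {c : CritPair k n d}
    (hc : c ∈ newPairs ord so SG' sp) : SigLess so sp c.toSigPoly := by
  obtain ⟨q, hq, hq0, hne, hc⟩ := mem_newPairs.1 hc
  have hq' := (hmem q hq).resolve_left hne
  rcases mem_jPair hc with ⟨⟨h1, h2, s, s', hs, hs', hlt⟩, rfl⟩ |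
    ⟨⟨h1, h2, s, s', hs, hs', hlt⟩, rfl⟩
  · refine ⟨s, _, hs, CritPair.isSig_toSigPoly hs, ModuleOrder.lt_shift (fun e => ?_) s⟩
    -- With trivial multiplier, the leading monomial of `q` divides that of `sp` and `q` would
    -- tm-reduce `sp`.
    have e : multiplier ord sp q = 0 := e
    rw [e, ModMon.shift_zero] at hlt
    refine hirr _ ⟨q, hq', multiplier ord q sp, ⟨h2, h1, ?_, s', s, hs', hs, hlt⟩, rfl⟩
    have hle : ord.degree q.2 ≤ ord.degree sp.2 := by
      unfold multiplier at e
      exact le_sup_right.trans (tsub_eq_zero_iff_le.1 e)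
    rw [multiplier, sup_eq_right.2 hle, tsub_add_cancel_of_le hle]
  · exact ⟨s', _, hs', CritPair.isSig_toSigPoly hs,
      ModuleOrder.lt_of_le_of_lt (ModuleOrder.le_shift _ _) hlt⟩

lemma mem_storeOne {c : CritPair k n d} : c ∈ storeOne so SG C ↔
    c ∈ C ∧ ¬ ∃ c' ∈ C, SameSig so c.toSigPoly c'.toSigPoly ∧ [c.first, c'.first].Sublist SG := by
  classical
  simp [storeOne]

/-- Of two pairs with equal signature and different first components, the one with the earlier first
component is dropped. -/
lemma storeOne_uniq (hC : ∀ c ∈ C, IsPairOf ord so SG c) {c c' : CritPair k n d}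
    (hc : c ∈ storeOne so SG C) (hc' : c' ∈ storeOne so SG C)
    (h : SameSig so c.toSigPoly c'.toSigPoly) : c = c' := by
  rw [mem_storeOne] at hc hc'
  obtain ⟨T, hT, hT'⟩ := id h
  by_cases e : c.first = c'.first
  · obtain ⟨s, hs, -⟩ := (hC c hc.1).exists_isSig
    exact CritPair.eq_of_first_eq e hs hT hT'
  · rcases pair_sublist_or (hC c hc.1).1 (hC c' hc'.1).1 e with h1 | h1
    · exact absurd ⟨c', hc'.1, h, h1⟩ hc.2
    · exact absurd ⟨c, hc.1, ⟨T, hT', hT⟩, h1⟩ hc'.2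

lemma mem_newSyz {z : SigPoly k n d} (h : z ∈ newSyz SG sp) :
    z ≠ 0 ∧ ∃ q ∈ SG, z = principalSyz sp q := by
  classical
  simp only [newSyz, Finset.mem_erase, Finset.mem_image, Finset.mem_filter,
    List.mem_toFinset] at h
  obtain ⟨h0, q, ⟨hq, -⟩, rfl⟩ := h
  exact ⟨h0, q, hq, rfl⟩

lemma syz_of_mem_newSyz (hSG : ∀ q ∈ SG, IsSigPoly f q) (hsp : IsSigPoly f sp)
    {z : SigPoly k n d} (h : z ∈ newSyz SG sp) : IsSigPoly f z ∧ z.2 = 0 ∧ z.1 ≠ 0 := by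
  obtain ⟨h0, q, hq, rfl⟩ := mem_newSyz h
  exact ⟨isSigPoly_principalSyz hsp (hSG q hq), rfl, fun e => h0 (Prod.ext e rfl)⟩

open Classical in
-- A pair dropped by `storeOne` is covered by the first component of its competitor, which is later
-- in the list. The competitor itself need not be kept.
lemma ReducingInv.insertNonSyz (h : ReducingInv ord so f SG P C cp sp)
    (hirr : ∀ sp', ¬ TmStep ord so SG sp sp') (hins : InsertF5GEN so sp cp SG SG')
    (hP : P' ⊆ P ∪ newSyz SG' sp) :
    LoopInv ord so f SG' P' (storeOne so SG' (C ∪ newPairs ord so SG' sp)) := by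
  obtain ⟨h1, h2, h3⟩ := h.insert hirr hins
  obtain ⟨s₀, hs₀, hT⟩ := h.isPair.exists_isSig
  have hsp := h.sp_sig _ hT
  have hspm : sp ∈ SG' := hins.mem_iff.2 (.inl rfl)
  have hnew : ∀ c ∈ newPairs ord so SG' sp, SigLess so sp c.toSigPoly := fun c hc =>
    sigLess_of_mem_newPairs hirr (fun q => hins.mem_iff.1) hc
  have hpair : ∀ c ∈ C ∪ newPairs ord so SG' sp, IsPairOf ord so SG' c := by
    intro c hc
    rcases Finset.mem_union.1 hc with hc | hc
    · exact h1.pair c hc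
    · obtain ⟨q, hq, hq0, hne, hc⟩ := mem_newPairs.1 hc
      rcases mem_jPair hc with ⟨h4, rfl⟩ | ⟨h4, rfl⟩
      · exact ⟨hspm, q, hq, h4, rfl⟩
      · exact ⟨hq, sp, hspm, h4, rfl⟩
  have hstore : ∀ c ∈ C ∪ newPairs ord so SG' sp, ∀ s, IsSig so c.first s →
      c ∈ storeOne so SG' (C ∪ newPairs ord so SG' sp) ∨
        Covered so f SG' c.first (s.shift c.mult) := by
    intro c hc s hs
    by_cases h4 : ∃ c' ∈ C ∪ newPairs ord so SG' sp, SameSig so c.toSigPoly c'.toSigPoly ∧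
        [c.first, c'.first].Sublist SG'
    · obtain ⟨c', hc', ⟨T, hT, hT'⟩, hl⟩ := h4
      obtain ⟨s', hs', hs''⟩ := (hpair c' hc').exists_isSig
      exact .inr (.inl ⟨c'.first, hl, s', c'.mult, hs',
        (hs''.unique hT').trans (hT.unique (CritPair.isSig_toSigPoly hs))⟩)
    · exact .inl (mem_storeOne.2 ⟨hc, h4⟩)
  refine { h1 with
    syz := ?_
    pair := fun c hc => hpair c (mem_storeOne.1 hc).1
    uniq := fun c hc c' hc' => storeOne_uniq hpair hc hc'
    less := ?_
    cov := ?_ }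
  · intro z hz
    rcases Finset.mem_union.1 (hP hz) with hz | hz
    · exact h.syz z hz
    · exact syz_of_mem_newSyz h1.sigPoly h.sp_sigPoly hz
  · intro q hq
    rcases h2 q hq with h4 | h4
    · exact .inl h4
    by_cases hu : ∃ i, q = unitSig f i
    · exact .inl hu
    refine .inr fun c hc => ?_
    rcases Finset.mem_union.1 (mem_storeOne.1 hc).1 with hc | hc
    · exact h4 c hc
    · rcases hins.mem_iff.1 hq with rfl | hq
      · exact hnew c hc
      · obtain ⟨s, s', hs, hs', hlt⟩ := (h.less q hq).resolve_left hu
        exact SigLess.trans ⟨s, s', hs, h.sp_sig s' hs', hlt⟩ (hnew c hc)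
  · intro a ha b hb s hab hs
    by_cases hmem : (⟨multiplier ord a b, a⟩ : CritPair k n d) ∈ C ∪ newPairs ord so SG' sp
    · exact hstore _ hmem s hs
    rw [Finset.mem_union, not_or, mem_newPairs] at hmem
    rcases hins.mem_iff.1 ha with rfl | ha'
    · refine absurd ⟨b, hb, hab.2.1, ?_, mem_jPair_left hab⟩ hmem.2
      rintro rfl
      exact hab.irrefl
    rcases hins.mem_iff.1 hb with rfl | hb'
    · refine absurd ⟨a, ha, hab.1, ?_, mem_jPair_right hab⟩ hmem.2
      rintro rfl
      exact hab.irrefl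
    exact .inr ((h3 a ha' b hb' s hab hs).resolve_left hmem.1)

open Classical in
lemma loopInv_initial (hf : ∀ i, f i ≠ 0) :
    LoopInv ord so f (List.ofFn (unitSig f))
      ((Finset.univ.filter fun p : Fin d × Fin d => p.1 < p.2).image
        fun p => principalSyz (unitSig f p.1) (unitSig f p.2))
      ((Finset.univ.filter fun p : Fin d × Fin d => p.1 < p.2).biUnion
        fun p => jPair ord so (unitSig f p.1) (unitSig f p.2)) := by
  have hpair : ∀ c ∈ (Finset.univ.filter fun p : Fin d × Fin d => p.1 < p.2).biUnion
        fun p => jPair ord so (unitSig f p.1) (unitSig f p.2),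
      ∃ i j, IsFirst ord so (unitSig f i) (unitSig f j) ∧
        c = ⟨multiplier ord (unitSig f i) (unitSig f j), unitSig f i⟩ := by
    intro c hc
    simp only [Finset.mem_biUnion, Finset.mem_filter] at hc
    obtain ⟨p, -, hc⟩ := hc
    rcases mem_jPair hc with ⟨h1, h2⟩ | ⟨h1, h2⟩
    exacts [⟨_, _, h1, h2⟩, ⟨_, _, h1, h2⟩]
  refine
    { nodup := ?_
      unit := fun i => List.mem_ofFn.2 ⟨i, rfl⟩
      sigPoly := ?_
      ne_zero := ?_
      homog := ?_
      syz := ?_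
      pair := ?_
      uniq := ?_
      less := fun q hq => ?_
      cov := ?_ }
  · refine List.nodup_ofFn.2 fun i j e => ?_
    -- Any module order would do here; the signature reveals the index.
    have := (isSig_unitSig (f := f) (f5Order ord f) i).unique (e ▸ isSig_unitSig _ j)
    exact congrArg ModMon.idx this
  · intro q hq
    obtain ⟨i, rfl⟩ := List.mem_ofFn.1 hq
    exact isSigPoly_unitSig i
  · intro q hq
    obtain ⟨i, rfl⟩ := List.mem_ofFn.1 hq
    exact (isSig_unitSig so i).ne_zero
  · intro hf q hq
    obtain ⟨i, rfl⟩ := List.mem_ofFn.1 hq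
    exact homogeneous_unitSig hf i
  · intro z hz
    simp only [Finset.mem_image, Finset.mem_filter, Finset.mem_univ, true_and] at hz
    obtain ⟨⟨i, j⟩, hij, rfl⟩ := hz
    refine ⟨isSigPoly_principalSyz (isSigPoly_unitSig i) (isSigPoly_unitSig j), rfl, fun e => ?_⟩
    -- Coordinate `j` of this syzygy is `f i`, which is nonzero.
    have := congrFun e j
    simp [principalSyz, unitSig, (show i < j from hij).ne', hf i] at this
  · intro c hc
    obtain ⟨i, j, h1, rfl⟩ := hpair c hc
    exact ⟨List.mem_ofFn.2 ⟨i, rfl⟩, _, List.mem_ofFn.2 ⟨j, rfl⟩, h1, rfl⟩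
  · intro c hc c' hc' ⟨T, hT, hT'⟩
    obtain ⟨i, j, h1, rfl⟩ := hpair c hc
    obtain ⟨i', j', h1', rfl⟩ := hpair c' hc'
    have e := congrArg ModMon.idx (hT.unique (CritPair.isSig_toSigPoly (isSig_unitSig so i)))
    have e' := congrArg ModMon.idx (hT'.unique (CritPair.isSig_toSigPoly (isSig_unitSig so i')))
    obtain rfl : i = i' := e.symm.trans e'
    exact CritPair.eq_of_first_eq rfl (isSig_unitSig so i) hT hT'
  · obtain ⟨i, rfl⟩ := List.mem_ofFn.1 hq
    exact .inl ⟨i, rfl⟩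
  · intro a ha b hb s hab hs
    obtain ⟨i, rfl⟩ := List.mem_ofFn.1 ha
    obtain ⟨j, rfl⟩ := List.mem_ofFn.1 hb
    left
    simp only [Finset.mem_biUnion, Finset.mem_filter, Finset.mem_univ, true_and]
    rcases lt_trichotomy i j with h | rfl | h
    · exact ⟨(i, j), h, mem_jPair_left hab⟩
    · exact (hab.irrefl).elim
    · exact ⟨(j, i), h, mem_jPair_right hab⟩

/-- The invariant of a state. -/
def State.Inv (ord : MonomialOrder (Fin n)) (so : ModuleOrder n d)
    (f : Fin d → MvPolynomial (Fin n) k) : State k n d → Prop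
  | .loop SG P C => LoopInv ord so f SG P C
  | .reducing SG P C cp sp => ReducingInv ord so f SG P C cp sp
  | .done G => ∃ SG P, LoopInv ord so f SG P ∅ ∧ G = {g | g ≠ 0 ∧ ∃ q ∈ SG, q.2 = g}

lemma Step.inv {S S' : State k n d} (h : Step ord so S S') (hS : S.Inv ord so f) :
    S'.Inv ord so f := by
  cases h with
  | reject SG P C cp hmin hrej => exact LoopInv.reject hS hrej hmin.1
  | select SG P C cp hmin hrej => exact LoopInv.select hS hmin hrej
  | tmReduce SG P C cp sp sp' h => exact ReducingInv.tmReduce hS h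
  | insertSyz SG SG' P C cp sp hirr hins hzero => exact ReducingInv.insertSyz hS hirr hins hzero
  | insertNonSyz SG SG' P P' C cp sp hirr hins hzero hP =>
    exact ReducingInv.insertNonSyz hS hirr hins hP.1
  | finish SG P => exact ⟨SG, P, hS, rfl⟩

lemma inv_initial (hf : ∀ i, f i ≠ 0) : (initial ord so f).Inv ord so f :=
  loopInv_initial hf

end Invariant

/-! ### No deadlock, and correctness of the output. -/

section Progress
variable {k : Type*} [Field k] {n d : ℕ} {ord : MonomialOrder (Fin n)} {so : ModuleOrder n d}
  {f : Fin d → MvPolynomial (Fin n) k} {SG SG' : List (SigPoly k n d)}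
  {P P' : Finset (SigPoly k n d)} {C : Finset (CritPair k n d)} {cp : CritPair k n d}
  {sp sp' q r : SigPoly k n d}

lemma exists_isMinPair (hC : ∀ c ∈ C, IsPairOf ord so SG c) (hne : C.Nonempty) :
    ∃ cp, IsMinPair so C cp := by
  obtain ⟨c, hc⟩ := hne
  obtain ⟨s, -, hs⟩ := (hC c hc).exists_isSig
  obtain ⟨T, ⟨cp, hcp, hT⟩, hmin⟩ :=
    so.wellFounded_lt.has_min {T | ∃ c ∈ C, IsSig so c.toSigPoly T} ⟨_, c, hc, hs⟩
  refine ⟨cp, hcp, fun c hc => ?_⟩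
  obtain ⟨s', -, hs'⟩ := (hC c hc).exists_isSig
  refine ⟨T, _, hT, hs', ?_⟩
  by_contra h
  exact hmin _ ⟨c, hc, hs'⟩ (ModuleOrder.lt_of_not_le h)

/-- Remove reducible elements one at a time. Divisibility of signatures is transitive, so whatever a
removed element was needed for is done by a survivor. -/
lemma exists_discardSuper (hP : ∀ z ∈ P, z.2 = 0 ∧ z.1 ≠ 0) : ∃ P', DiscardSuper ord so P P' := by
  classical
  induction P using Finset.strongInduction with
  | _ P ih =>
  by_cases h : ∃ z ∈ P, ∃ z' ∈ P, z' ≠ z ∧ SuperReduces ord so z' z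
  · obtain ⟨z, hz, z', hz', hne, hred⟩ := h
    obtain ⟨P', h1, h2, h3⟩ := ih (P.erase z) (Finset.erase_ssubset hz)
      fun w hw => hP w (Finset.mem_of_mem_erase hw)
    refine ⟨P', h1.trans (Finset.erase_subset _ _), fun w hw => ?_, h3⟩
    by_cases e : w = z
    · subst e
      obtain ⟨z'', hz'', s, t, hs, ht, -⟩ := h2 z' (Finset.mem_erase.2 ⟨hne, hz'⟩)
      obtain ⟨s', t', hs', ht', -⟩ := hred
      refine ⟨z'', hz'', s, t' + t, hs, ?_,
        .inl ⟨(hP _ (Finset.mem_of_mem_erase (h1 hz''))).1, (hP _ hz).1⟩⟩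
      rwa [hs'.unique ht, ModMon.shift_shift] at ht'
    · exact h2 w (Finset.mem_erase.2 ⟨e, hw⟩)
  · refine ⟨P, Finset.Subset.refl P, fun z hz => ⟨z, hz, ?_⟩,
      fun z hz z' hz' hne hred => h ⟨z, hz, z', hz', hne, hred⟩⟩
    obtain ⟨s, hs⟩ := exists_isSig so (hP z hz).2
    exact ⟨s, 0, hs, by rwa [ModMon.shift_zero], .inl ⟨(hP z hz).1, (hP z hz).1⟩⟩

/-- Inserting directly behind the first component is always allowed. -/
lemma ReducingInv.exists_insert (h : ReducingInv ord so f SG P C cp sp) :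
    ∃ SG', InsertF5GEN so sp cp SG SG' := by
  obtain ⟨s, hs, hT⟩ := h.isPair.exists_isSig
  have hidx : SameIdx so cp.first sp := ⟨s, _, hs, h.sp_sig _ hT, rfl⟩
  obtain ⟨A, B, hSG⟩ := List.append_of_mem h.isPair.1
  exact ⟨(A ++ [cp.first]) ++ sp :: B, A ++ [cp.first], B, by simp [hSG], rfl, by simp,
    .inl ⟨cp.first, by simp, hidx⟩, .inr ⟨A, cp.first, rfl, hidx⟩⟩

lemma State.Inv.exists_done {S : State k n d} (h : S.Inv ord so f)
    (hstuck : ∀ S', ¬ Step ord so S S') : ∃ G, S = .done G := by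
  classical
  cases S with
  | loop SG P C =>
    have h : LoopInv ord so f SG P C := h
    rcases C.eq_empty_or_nonempty with rfl | hne
    · exact absurd (.finish SG P) (hstuck _)
    · obtain ⟨cp, hmin⟩ := exists_isMinPair h.pair hne
      by_cases hrej : Rejected ord so SG P cp
      · exact absurd (.reject SG P C cp hmin hrej) (hstuck _)
      · exact absurd (.select SG P C cp hmin hrej) (hstuck _)
  | reducing SG P C cp sp =>
    have h : ReducingInv ord so f SG P C cp sp := h
    have hirr : ∀ sp', ¬ TmStep ord so SG sp sp' := fun sp' h' =>
      hstuck _ (.tmReduce SG P C cp sp sp' h')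
    obtain ⟨SG', hins⟩ := h.exists_insert
    by_cases h0 : sp.2 = 0
    · exact absurd (.insertSyz SG SG' P C cp sp hirr hins h0) (hstuck _)
    · have hsp := (h.insert hirr hins).1.sigPoly
      obtain ⟨P', hP'⟩ := exists_discardSuper (ord := ord) (so := so) (P := P ∪ newSyz SG' sp)
        fun z hz => by
          rcases Finset.mem_union.1 hz with hz | hz
          · exact (h.syz z hz).2
          · exact (syz_of_mem_newSyz hsp h.sp_sigPoly hz).2
      exact absurd (.insertNonSyz SG SG' P P' C cp sp hirr hins h0 hP') (hstuck _)
  | done G => exact ⟨G, rfl⟩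

lemma State.Inv.isGroebnerBasis {G : Set (MvPolynomial (Fin n) k)}
    (h : (State.done G : State k n d).Inv ord so f) :
    IsGroebnerBasis ord G (Ideal.span (Set.range f)) := by
  obtain ⟨SG, P, h, rfl⟩ := h
  refine ⟨?_, ?_, fun p hp hp0 => ?_⟩
  · refine (SG.finite_toSet.image Prod.snd).subset ?_
    rintro g ⟨-, q, hq, rfl⟩
    exact ⟨q, hq, rfl⟩
  · rintro g ⟨-, q, hq, rfl⟩
    rw [← h.sigPoly q hq]
    exact Ideal.sum_mem _ fun i _ => Ideal.mul_mem_left _ _ (Ideal.subset_span ⟨i, rfl⟩)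
  · obtain ⟨q, hq, hq0, hle⟩ := exists_degree_le_of_covered h.nodup h.unit h.sigPoly
      (fun a ha b hb s hab hs => (h.cov a ha b hb s hab hs).resolve_left (Finset.notMem_empty _))
      hp hp0
    exact ⟨q.2, ⟨hq0, q, hq, rfl⟩, hq0, hle⟩

end Progress

/-- A relation with finitely many successors of each element and without infinite paths reaches
only finitely many elements from a given one. -/
lemma finite_reflTransGen {α : Type*} {r : α → α → Prop} (hfin : ∀ a, {b | r a b}.Finite)
    (hwf : WellFounded fun b a => r a b) (a : α) : {b | Relation.ReflTransGen r a b}.Finite := by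
  induction a using hwf.induction with
  | _ a ih =>
  refine ((Set.finite_singleton a).union ((hfin a).biUnion ih)).subset fun b hb => ?_
  rcases Relation.ReflTransGen.cases_head hb with rfl | ⟨c, hac, hcb⟩
  · exact .inl rfl
  · exact .inr (Set.mem_biUnion (x := c) hac hcb)

/-! ### Termination of the main loop. -/

section Termination
variable {k : Type*} [Field k] {n d : ℕ} {ord : MonomialOrder (Fin n)} {so : ModuleOrder n d}
  {f : Fin d → MvPolynomial (Fin n) k}

/-- The module order is compatible with the monomial order, or it is the order of the F5 algorithm
and the input is homogeneous. -/
def WeaklyCompatible (ord : MonomialOrder (Fin n)) (so : ModuleOrder n d)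
    (f : Fin d → MvPolynomial (Fin n) k) : Prop :=
  so.Compatible ord ∨ (so = f5Order ord f ∧ ∀ i, ∃ e, (f i).IsHomogeneous e)

/-- The monomial of `s.shift a` is smaller than that of `s'`, which suffices for a compatible order.
For the F5 order, homogeneity makes both g-weighted degrees equal to that of the leading monomial of
`q'`, so the monomials decide. -/
lemma WeaklyCompatible.shift_lt (h : WeaklyCompatible ord so f) {q q' : SigPoly k n d}
    (hq : (∀ i, ∃ e, (f i).IsHomogeneous e) → Homogeneous ord so f q)
    (hq' : (∀ i, ∃ e, (f i).IsHomogeneous e) → Homogeneous ord so f q')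
    (hq0 : q.2 ≠ 0) (hq0' : q'.2 ≠ 0) {s s' : ModMon n d} (hs : IsSig so q s)
    (hs' : IsSig so q' s') (hidx : s.idx = s'.idx) {a b : Fin n →₀ ℕ}
    (ha : a + ord.degree q.2 = ord.degree q'.2) (hb : b + s.mon = s'.mon)
    (hab : ord.toSyn a < ord.toSyn b) : so.lt (s.shift a) s' := by
  have hmon : ord.toSyn (a + s.mon) < ord.toSyn s'.mon := by
    rw [← hb, map_add, map_add]
    gcongr
  refine ⟨?_, fun e => hmon.ne (by rw [← e, ModMon.shift_mon])⟩
  rcases h with h | ⟨rfl, hf⟩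
  · rw [show s' = ⟨s.idx, s'.mon⟩ from ModMon.ext hidx.symm rfl]
    exact (h _ _ _).2 hmon.le
  · refine .inr ⟨hidx, .inr ⟨?_, hmon.le⟩⟩
    rw [← degree_degree_of_isHomogeneous (ord := ord) (hq' hf s' hs') hq0', ← ha, map_add,
      degree_degree_of_isHomogeneous (ord := ord) (hq hf s hs) hq0]
    simp [gwDeg, add_assoc]

/-- The list `SG'` of a state. -/
def State.list : State k n d → List (SigPoly k n d)
  | .loop SG _ _ => SG
  | .reducing SG _ _ _ _ => SG
  | .done _ => []

/-- The step from `S` to `S'` inserts `q`, obtained from a J-pair with first component `p`. -/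
def InsertsAt (S S' : State k n d) (p q : SigPoly k n d) : Prop :=
  ∃ SG SG' P P' C C' cp, S = .reducing SG P C cp q ∧ S' = .loop SG' P' C' ∧ cp.first = p

lemma Step.list_cases {S S' : State k n d} (h : Step ord so S S') (hS' : ∀ G, S' ≠ .done G) :
    S'.list = S.list ∨ ∃ p q, InsertsAt S S' p q ∧ S.list.Sublist S'.list ∧
      ∀ x ∈ S'.list, x = q ∨ x ∈ S.list := by
  cases h with
  | reject => exact .inl rfl
  | select => exact .inl rfl
  | tmReduce => exact .inl rfl
  | insertSyz SG SG' P C cp sp hirr hins hzero =>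
    exact .inr ⟨_, sp, ⟨_, _, _, _, _, _, _, rfl, rfl, rfl⟩, hins.sublist,
      fun x => hins.mem_iff.1⟩
  | insertNonSyz SG SG' P P' C cp sp hirr hins hzero hP =>
    exact .inr ⟨_, sp, ⟨_, _, _, _, _, _, _, rfl, rfl, rfl⟩, hins.sublist,
      fun x => hins.mem_iff.1⟩
  | finish => exact absurd rfl (hS' _)

/-- What is known about an inserted element. -/
structure InsertSpec (ord : MonomialOrder (Fin n)) (so : ModuleOrder n d)
    (f : Fin d → MvPolynomial (Fin n) k) (SG SG' : List (SigPoly k n d))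
    (p q : SigPoly k n d) : Prop where
  notMem : q ∉ SG
  mem : q ∈ SG'
  first_mem : p ∈ SG
  first_ne : p.2 ≠ 0
  sig : ∃ s m, IsSig so p s ∧ IsSig so q (s.shift m) ∧
    (q.2 ≠ 0 → ord.toSyn (ord.degree q.2) < ord.toSyn (m + ord.degree p.2))
  irr : ∀ r ∈ SG, ∀ t, ¬ TmReducesAt ord so r q t
  pair : [p, q].Sublist SG'
  not_dvd : ∀ r, [p, r].Sublist SG → ¬ SigDvd so r q

lemma InsertsAt.spec {S S' : State k n d} {p q : SigPoly k n d} (h : InsertsAt S S' p q)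
    (hstep : Step ord so S S') (hinv : S.Inv ord so f) :
    InsertSpec ord so f S.list S'.list p q := by
  obtain ⟨SG, SG', P, P', C, C', cp, rfl, rfl, rfl⟩ := h
  have hI : ReducingInv ord so f SG P C cp q := hinv
  obtain ⟨hirr, hins⟩ : (∀ sp', ¬ TmStep ord so SG q sp') ∧ InsertF5GEN so q cp SG SG' := by
    cases hstep with
    | insertSyz _ _ _ _ _ _ hirr hins => exact ⟨hirr, hins⟩
    | insertNonSyz _ _ _ _ _ _ _ hirr hins => exact ⟨hirr, hins⟩
  obtain ⟨s, hs, hT⟩ := hI.isPair.exists_isSig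
  have hq := hI.sp_sig _ hT
  exact
    { notMem := hI.notMem hirr
      mem := hins.mem_iff.2 (.inl rfl)
      first_mem := hI.isPair.1
      first_ne := hI.isPair.snd_ne_zero
      sig := by
        refine ⟨s, cp.mult, hs, hq, fun h0 => ?_⟩
        rw [← hI.isPair.degree_toSigPoly]
        rcases hI.sp_degree with e | h1
        -- At least one reduction has taken place, since an unreduced J-pair is tm-reducible by its
        -- second component.
        · obtain ⟨sp', h2⟩ := hI.isPair.exists_tmStep
          exact absurd (e ▸ h2) (hirr sp')
        · exact h1 h0
      irr := fun r hr t ht => hirr _ ⟨r, hr, t, ht, rfl⟩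
      pair := hins.pair_sublist
      not_dvd := fun r hr ⟨s', t, hs', ht⟩ => by
        -- As `cp` is not F5-rewritable, the last element whose signature divides that of `cp` is
        -- its first component.
        obtain ⟨A, x, B, e, hx, hB⟩ := exists_last_split (L := SG)
          (p := fun x => SigDvd so x cp.toSigPoly) ⟨_, hI.isPair.1, s, cp.mult, hs, hT⟩
        have hxe : x = cp.first := by
          by_contra hne
          exact hI.notRewritable ⟨A, x, B, e, hx, hB, hne⟩
        subst hxe
        have hn := hI.nodup
        change [cp.first, r].Sublist SG at hr
        rw [e] at hr hn
        refine hB r (mem_of_pair_sublist hn hr) ⟨s', t, hs', ?_⟩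
        rwa [ht.unique hq] }

/-- An infinite run of the algorithm inserts infinitely often. -/
lemma infinite_insertsAt {run : ℕ → State k n d} (hstep : ∀ i, Step ord so (run i) (run (i + 1))) :
    {i | ∃ p q, InsertsAt (run i) (run (i + 1)) p q}.Infinite := by
  classical
  intro hfin
  obtain ⟨N, hN⟩ := hfin.bddAbove
  -- Without insertions, taking a J-pair shrinks `C` and a tm-reduction lowers the leading monomial;
  -- a zero polynomial gets the value `⊥`.
  let μ : State k n d → ℕ ×ₗ WithBot ord.syn := fun S => match S with
    | .loop _ _ C => toLex (C.card, ⊥)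
    | .reducing _ _ C _ sp =>
      toLex (C.card, if sp.2 = 0 then ⊥ else (ord.toSyn (ord.degree sp.2) : WithBot ord.syn))
    | .done _ => toLex (0, ⊥)
  have hdec : ∀ i, μ (run (N + 1 + (i + 1))) < μ (run (N + 1 + i)) := by
    intro i
    have h1 := hstep (N + 1 + i)
    have h2 := hstep (N + 1 + i + 1)
    have h3 : ¬ ∃ p q, InsertsAt (run (N + 1 + i)) (run (N + 1 + i + 1)) p q := fun h => by
      have := hN h
      omega
    rw [← add_assoc]
    generalize run (N + 1 + i) = S at *
    generalize run (N + 1 + i + 1) = S' at *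
    generalize run (N + 1 + i + 1 + 1) = S'' at *
    cases h1 with
    | reject SG P C cp hmin hrej =>
      exact Prod.Lex.toLex_lt_toLex.2 (.inl (Finset.card_erase_lt_of_mem hmin.1))
    | select SG P C cp hmin hrej =>
      exact Prod.Lex.toLex_lt_toLex.2 (.inl (Finset.card_erase_lt_of_mem hmin.1))
    | tmReduce SG P C cp sp sp' h =>
      refine Prod.Lex.toLex_lt_toLex.2 (.inr ⟨rfl, ?_⟩)
      obtain ⟨h4, h5⟩ := h.degree_lt
      simp only [h4, if_false]
      split_ifs with h6
      · exact WithBot.bot_lt_coe _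
      · exact WithBot.coe_lt_coe.2 (h5 h6)
    | insertSyz => exact absurd ⟨_, _, _, _, _, _, _, _, _, rfl, rfl, rfl⟩ h3
    | insertNonSyz => exact absurd ⟨_, _, _, _, _, _, _, _, _, rfl, rfl, rfl⟩ h3
    | finish => cases h2
  exact (wellFounded_iff_isEmpty_descending_chain.1
    (wellFounded_lt (α := ℕ ×ₗ WithBot ord.syn))).false ⟨fun i => μ (run (N + 1 + i)), hdec⟩

/-! ### The forest of inserted elements of an infinite run. -/

section Run
variable {run : ℕ → State k n d}

/-- `q` is inserted at some time as the reduction of a multiple of `p`. -/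
def Child (run : ℕ → State k n d) (p q : SigPoly k n d) : Prop :=
  ∃ i, InsertsAt (run i) (run (i + 1)) p q

lemma run_ne_done (hstep : ∀ i, Step ord so (run i) (run (i + 1)))
    (i : ℕ) (G : Set (MvPolynomial (Fin n) k)) : run i ≠ .done G := by
  intro e
  have := hstep i
  rw [e] at this
  cases this

lemma run_list_sublist (hstep : ∀ i, Step ord so (run i) (run (i + 1)))
    {i j : ℕ} (hij : i ≤ j) : (run i).list.Sublist (run j).list := by
  induction hij with
  | refl => exact List.Sublist.refl _
  | @step j _ ih =>
    refine ih.trans ?_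
    rcases (hstep j).list_cases (run_ne_done hstep (j + 1)) with e | ⟨p, q, -, h, -⟩
    · rw [e]
    · exact h

/-- By Dickson's lemma, one of infinitely many multipliers of `p` divides a later one. The earlier
child then stands after `p` and its signature divides that of the later child, against the F5
criterion. -/
lemma finite_child (hstep : ∀ i, Step ord so (run i) (run (i + 1)))
    (hinv : ∀ i, (run i).Inv ord so f)
    (p : SigPoly k n d) : {q | Child run p q}.Finite := by
  by_contra hinf
  have hI : {i | ∃ q, InsertsAt (run i) (run (i + 1)) p q}.Infinite := by
    intro hfin
    refine hinf ((hfin.biUnion (t := fun i => {q | InsertsAt (run i) (run (i + 1)) p q})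
      fun i _ => Set.Subsingleton.finite ?_).subset ?_)
    · rintro q ⟨_, _, _, _, _, _, _, e, -⟩ q' ⟨_, _, _, _, _, _, _, e', -⟩
      rw [e] at e'
      cases e'
      rfl
    · rintro q ⟨i, h⟩
      exact Set.mem_biUnion (x := i) ⟨q, h⟩ h
  let e := Nat.nth fun i => ∃ q, InsertsAt (run i) (run (i + 1)) p q
  have he : ∀ j, ∃ q, InsertsAt (run (e j)) (run (e j + 1)) p q := Nat.nth_mem_of_infinite hI
  choose q hq using he
  have hspec := fun j => (hq j).spec (hstep (e j)) (hinv (e j))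
  choose s m hs hm _ using fun j => (hspec j).sig
  obtain ⟨i, j, hij, hle⟩ := wellQuasiOrdered_le (α := Fin n →₀ ℕ) m
  have hlt : e i + 1 ≤ e j := Nat.nth_strictMono hI hij
  refine (hspec j).not_dvd (q i) ((hspec i).pair.trans (run_list_sublist hstep hlt))
    ⟨_, m j - m i, hm i, ?_⟩
  rw [ModMon.shift_shift, tsub_add_cancel_of_le hle, (hs i).unique (hs j)]
  exact hm j

/-- Along a branch the signature is multiplied by `m j`, while the leading monomial grows by
strictly less. Dickson's lemma on pairs of signature and leading monomial then gives a tm-reduction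
of a descendant by an ancestor. -/
lemma wellFounded_child (hstep : ∀ i, Step ord so (run i) (run (i + 1)))
    (hinv : ∀ i, (run i).Inv ord so f)
    (hc : WeaklyCompatible ord so f) :
    WellFounded fun q p => Child run p q := by
  rw [wellFounded_iff_isEmpty_descending_chain]
  refine ⟨fun ⟨q, hq⟩ => ?_⟩
  choose i hi using hq
  have hspec := fun j => (hi j).spec (hstep (i j)) (hinv (i j))
  have himono : StrictMono i := strictMono_nat_of_lt_succ fun j => by
    by_contra hlt
    exact (hspec j).notMem ((run_list_sublist hstep (not_lt.1 hlt)).subset (hspec (j + 1)).first_mem)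
  choose s m hs hm hdeg using fun j => (hspec j).sig
  have hsucc : ∀ j, s (j + 1) = (s j).shift (m j) := fun j => (hs (j + 1)).unique (hm j)
  have hidx : ∀ j, (s j).idx = (s 0).idx := fun j => by
    induction j with
    | zero => rfl
    | succ j ih => rw [hsucc, ModMon.shift_idx, ih]
  -- The decrease of the quotient of leading monomial by signature, with denominators cleared.
  have hratio : ∀ a b, a < b → ord.toSyn (ord.degree (q b).2 + (s a).mon) <
      ord.toSyn (ord.degree (q a).2 + (s b).mon) := by
    intro a b hab
    have hone : ∀ j, ord.toSyn (ord.degree (q (j + 1)).2) <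
        ord.toSyn (m j) + ord.toSyn (ord.degree (q j).2) := fun j => by
      rw [← map_add]
      exact hdeg j (hspec (j + 1)).first_ne
    induction hab with
    | refl =>
      rw [Nat.succ_eq_add_one, hsucc, ModMon.shift_mon]
      simp only [map_add]
      calc _ < ord.toSyn (m a) + ord.toSyn (ord.degree (q a).2) + ord.toSyn (s a).mon := by
            gcongr
            exact hone a
        _ = _ := by abel
    | @step b _ ih =>
      rw [Nat.succ_eq_add_one, hsucc, ModMon.shift_mon]
      simp only [map_add] at ih ⊢
      calc _ < ord.toSyn (m b) + ord.toSyn (ord.degree (q b).2) + ord.toSyn (s a).mon := by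
            gcongr
            exact hone b
        _ = ord.toSyn (m b) + (ord.toSyn (ord.degree (q b).2) + ord.toSyn (s a).mon) := by abel
        _ < ord.toSyn (m b) + (ord.toSyn (ord.degree (q a).2) + ord.toSyn (s b).mon) := by
            gcongr
        _ = _ := by abel
  obtain ⟨a, b, hab, h1, h2⟩ := (wellQuasiOrdered_le (α := Fin n →₀ ℕ)).prod
    (wellQuasiOrdered_le (α := Fin n →₀ ℕ)) fun j => ((s j).mon, ord.degree (q j).2)
  dsimp only at h1 h2
  obtain ⟨u, hu⟩ := exists_add_of_le h1
  obtain ⟨v, hv⟩ := exists_add_of_le h2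
  have huv : ord.toSyn v < ord.toSyn u := by
    have h3 := hratio a b hab
    rw [hu, hv] at h3
    simp only [map_add] at h3
    have h4 : ord.toSyn (ord.degree (q a).2) + ord.toSyn (s a).mon + ord.toSyn v <
        ord.toSyn (ord.degree (q a).2) + ord.toSyn (s a).mon + ord.toSyn u := by
      convert h3 using 1 <;> abel
    exact lt_of_add_lt_add_left h4
  have hmem : ∀ j, q j ∈ (run (i j)).list := fun j => (hspec j).first_mem
  have hhom : ∀ j, (∀ i, ∃ e, (f i).IsHomogeneous e) → Homogeneous ord so f (q j) := by
    intro j hf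
    have h3 := hinv (i j)
    have h4 := hmem j
    generalize run (i j) = S at h3 h4
    cases S with
    | loop SG P C => exact LoopInv.toBaseInv h3 |>.homog hf _ h4
    | reducing SG P C cp sp => exact ReducingInv.toBaseInv h3 |>.homog hf _ h4
    | done G => simp [State.list] at h4
  have hlt := hc.shift_lt (hhom a) (hhom b) (hspec a).first_ne (hspec b).first_ne (hs a) (hs b)
    ((hidx a).trans (hidx b).symm) (a := v) (b := u) (by rw [hv, add_comm]) (by rw [hu, add_comm])
    huv
  -- `q (c + 1)` is inserted at time `i c`. As `a ≤ c`, the reducer `q a` is already in the list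
  -- then.
  obtain ⟨c, rfl⟩ : ∃ c, b = c + 1 := ⟨b - 1, by omega⟩
  refine (hspec c).irr (q a) ((run_list_sublist hstep (himono.monotone
    (Nat.lt_succ_iff.1 hab))).subset (hmem a)) v ⟨(hspec a).first_ne, (hspec (c + 1)).first_ne,
    by rw [hv, add_comm], s a, s (c + 1), hs a, hs (c + 1), hlt⟩

/-- König's argument: every element descends from the finite list at time `0`, and the forest has
finite branching and no infinite branch. -/
lemma finite_run_list (hstep : ∀ i, Step ord so (run i) (run (i + 1)))
    (hinv : ∀ i, (run i).Inv ord so f)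
    (hc : WeaklyCompatible ord so f) : {q | ∃ i, q ∈ (run i).list}.Finite := by
  refine ((run 0).list.finite_toSet.biUnion fun p _ =>
    finite_reflTransGen (finite_child hstep hinv) (wellFounded_child hstep hinv hc) p).subset ?_
  rintro q ⟨i, hq⟩
  rw [Set.mem_iUnion₂]
  revert q
  induction i with
  | zero => exact fun q hq => ⟨q, hq, .refl⟩
  | succ i ih =>
    intro q hq
    rcases (hstep i).list_cases (run_ne_done hstep (i + 1)) with e | ⟨p, q', h, -, hmem⟩
    · exact ih (e ▸ hq)
    · rcases hmem q hq with rfl | hq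
      · obtain ⟨p', hp', hr⟩ := ih (h.spec (hstep i) (hinv i)).first_mem
        exact ⟨p', hp', hr.tail ⟨i, h⟩⟩
      · exact ih hq

end Run

lemma terminates_of_inv (hc : WeaklyCompatible ord so f) {S : State k n d}
    (hS : S.Inv ord so f) : Terminates (Step ord so) S := by
  rintro ⟨run, h0, hstep⟩
  have hinv : ∀ i, (run i).Inv ord so f := fun i => by
    induction i with
    | zero => exact h0 ▸ hS
    | succ i ih => exact (hstep i).inv ih
  have hE := infinite_insertsAt hstep
  have hV := finite_run_list hstep hinv hc
  choose! p q hpq using fun (i : ℕ) (hi : i ∈ {i | ∃ p q, InsertsAt (run i) (run (i + 1)) p q}) => hi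
  have hmaps : Set.MapsTo q {i | ∃ p q, InsertsAt (run i) (run (i + 1)) p q}
      {q | ∃ i, q ∈ (run i).list} :=
    fun i hi => ⟨i + 1, ((hpq i hi).spec (hstep i) (hinv i)).mem⟩
  -- Infinitely many insertions into a finite set repeat an element, although every inserted element
  -- is new.
  obtain ⟨i, hi, j, hj, hne, e⟩ := hE.exists_ne_map_eq_of_mapsTo hmaps hV
  wlog hij : i < j generalizing i j
  · exact this j hj i hi hne.symm e.symm (lt_of_le_of_ne (not_lt.1 hij) hne.symm)
  refine ((hpq j hj).spec (hstep j) (hinv j)).notMem ?_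
  rw [← e]
  exact (run_list_sublist hstep hij).subset ((hpq i hi).spec (hstep i) (hinv i)).mem

theorem computesGroebnerBasis_of_ne_zero (hf : ∀ i, f i ≠ 0) (hc : WeaklyCompatible ord so f) :
    ComputesGroebnerBasis ord so f (Ideal.span (Set.range f)) := by
  refine ⟨terminates_of_inv hc (inv_initial hf), fun S hS hstuck => ?_⟩
  have hinv : S.Inv ord so f := by
    clear hstuck
    induction hS with
    | refl => exact inv_initial hf
    | tail _ h ih => exact h.inv ih
  obtain ⟨G, rfl⟩ := hinv.exists_done hstuck
  exact ⟨G, rfl, hinv.isGroebnerBasis⟩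

end Termination

/-! ### Interreduction. -/

section Interreduction
variable {k : Type*} [Field k] {n : ℕ} {ord : MonomialOrder (Fin n)}

lemma terminates_of_wellFounded {α : Type*} {step r : α → α → Prop} (hr : WellFounded r)
    (h : ∀ x y, step x y → r y x) (x : α) : Terminates step x := fun ⟨run, _, hrun⟩ =>
  (wellFounded_iff_isEmpty_descending_chain.1 hr).false ⟨run, fun i => h _ _ (hrun i)⟩

/-- The multiset of the monomials of a polynomial. -/
noncomputable def monomials (ord : MonomialOrder (Fin n)) (p : MvPolynomial (Fin n) k) :
    Multiset ord.syn :=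
  ∑ m ∈ p.support, {ord.toSyn m}

lemma coeff_sub_reduce_eq_zero {f g : MvPolynomial (Fin n) k} (hg0 : g ≠ 0) (t : Fin n →₀ ℕ) :
    coeff (t + ord.degree g)
      (f - monomial t (f.coeff (t + ord.degree g) / ord.leadingCoeff g) * g) = 0 := by
  have h : coeff (ord.degree g) g = ord.leadingCoeff g := rfl
  rw [coeff_sub, coeff_monomial_mul, h, div_mul_cancel₀ _ (ord.leadingCoeff_ne_zero_iff.2 hg0),
    sub_self]

lemma toSyn_lt_of_mem_support_reduce {f g : MvPolynomial (Fin n) k} {t y : Fin n →₀ ℕ} {c : k}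
    (ht : t + ord.degree g ∈ f.support) (hy : y ∈ (f - monomial t c * g).support)
    (hyf : y ∉ f.support) : ord.toSyn y < ord.toSyn (t + ord.degree g) := by
  rw [mem_support_iff, coeff_sub, notMem_support_iff.1 hyf, zero_sub, neg_ne_zero,
    coeff_monomial_mul'] at hy
  split_ifs at hy with hle
  · refine lt_of_le_of_ne ?_ fun e => hyf (ord.toSyn.injective e ▸ ht)
    have h1 := ord.le_degree (mem_support_iff.2 (right_ne_zero_of_mul hy))
    rw [← add_tsub_cancel_of_le hle, map_add, map_add]
    gcongr
  · exact absurd rfl hy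

/-- The cancelled monomial disappears, and every monomial that newly appears comes from a lower term
of the multiple of `g`, so it is smaller. `M` stands for the other polynomials. -/
lemma isDershowitzMannaLT_reduce (M : Multiset ord.syn) {f g : MvPolynomial (Fin n) k}
    {t : Fin n →₀ ℕ} (hg0 : g ≠ 0) (ht : t + ord.degree g ∈ f.support) :
    Multiset.IsDershowitzMannaLT
      (M + monomials ord (f - monomial t (f.coeff (t + ord.degree g) / ord.leadingCoeff g) * g))
      (M + monomials ord f) := by
  classical
  set f' := f - monomial t (f.coeff (t + ord.degree g) / ord.leadingCoeff g) * g with hf'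
  have hm : t + ord.degree g ∈ f.support \ f'.support :=
    Finset.mem_sdiff.2 ⟨ht, notMem_support_iff.2 (coeff_sub_reduce_eq_zero hg0 t)⟩
  have hmZ : ord.toSyn (t + ord.degree g) ∈
      ∑ m ∈ f.support \ f'.support, ({ord.toSyn m} : Multiset ord.syn) :=
    Multiset.mem_sum.2 ⟨_, hm, Multiset.mem_singleton_self _⟩
  refine ⟨M + ∑ m ∈ f.support ∩ f'.support, {ord.toSyn m},
    ∑ m ∈ f'.support \ f.support, {ord.toSyn m},
    ∑ m ∈ f.support \ f'.support, {ord.toSyn m}, ?_, ?_, ?_, fun y hy => ?_⟩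
  · intro e
    rw [e] at hmZ
    exact Multiset.notMem_zero _ hmZ
  · rw [add_assoc, Finset.inter_comm, Finset.sum_inter_add_sum_sdiff, monomials]
  · rw [add_assoc, Finset.sum_inter_add_sum_sdiff, monomials]
  · obtain ⟨m, hm, hy⟩ := Multiset.mem_sum.1 hy
    rw [Multiset.mem_singleton.1 hy]
    rw [Finset.mem_sdiff] at hm
    exact ⟨_, hmZ, toSyn_lt_of_mem_support_reduce ht hm.1 hm.2⟩

theorem terminates_interreduceStep (F : List (MvPolynomial (Fin n) k)) :
    Terminates (InterreduceStep ord) F := by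
  -- Dropping a zero polynomial leaves the multiset unchanged, so the length of the list serves as
  -- second component.
  refine terminates_of_wellFounded
    (InvImage.wf (fun L : List (MvPolynomial (Fin n) k) =>
      ((L.map (monomials ord)).sum, L.length))
      (WellFounded.prod_lex Multiset.wellFounded_isDershowitzMannaLT wellFounded_lt)) ?_ F
  intro L L' h
  cases h with
  | reduce A B f g t hg hg0 ht =>
    refine Prod.Lex.left _ _ ?_
    have := isDershowitzMannaLT_reduce
      ((A.map (monomials ord)).sum + (B.map (monomials ord)).sum) hg0 ht
    simpa only [List.map_append, List.map_cons, List.sum_append, List.sum_cons, add_assoc,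
      add_comm (List.sum (B.map (monomials ord)))] using this
  | drop A B =>
    simp only [InvImage, List.map_append, List.map_cons, List.sum_append, List.sum_cons,
      monomials, support_zero, Finset.sum_empty, zero_add, List.length_append, List.length_cons]
    exact Prod.Lex.right _ (by omega)

lemma InterreduceStep.span_eq {L L' : List (MvPolynomial (Fin n) k)}
    (h : InterreduceStep ord L L') :
    Ideal.span {p | p ∈ L'} = Ideal.span {p | p ∈ L} := by
  cases h with
  | reduce A B f g t hg hg0 ht =>
    set c := monomial t (f.coeff (t + ord.degree g) / ord.leadingCoeff g)
    have hsub : ∀ (x : MvPolynomial (Fin n) k), ∀ p ∈ A ++ B,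
        p ∈ Ideal.span {p | p ∈ A ++ x :: B} := fun x p hp => Ideal.subset_span (by
      simp only [List.mem_append, List.mem_cons, Set.mem_ofPred_eq] at hp ⊢
      tauto)
    have hself : ∀ x : MvPolynomial (Fin n) k, x ∈ Ideal.span {p | p ∈ A ++ x :: B} :=
      fun x => Ideal.subset_span (by simp)
    refine _root_.le_antisymm (Ideal.span_le.2 fun p hp => ?_) (Ideal.span_le.2 fun p hp => ?_)
    · by_cases e : p = f - c * g
      · subst e
        exact Ideal.sub_mem _ (hself f) (Ideal.mul_mem_left _ _ (hsub f g hg))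
      · refine hsub f p ?_
        simp only [List.mem_append, List.mem_cons, Set.mem_ofPred_eq] at hp ⊢
        tauto
    · by_cases e : p = f
      · subst e
        have := Ideal.add_mem _ (hself (p - c * g)) (Ideal.mul_mem_left _ c (hsub (p - c * g) g hg))
        rwa [sub_add_cancel] at this
      · refine hsub _ p ?_
        simp only [List.mem_append, List.mem_cons, Set.mem_ofPred_eq] at hp ⊢
        tauto
  | drop A B =>
    refine _root_.le_antisymm (Ideal.span_mono fun p hp => ?_) (Ideal.span_le.2 fun p hp => ?_)
    · simp only [List.mem_append, List.mem_cons, Set.mem_ofPred_eq] at hp ⊢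
      tauto
    · by_cases e : p = 0
      · subst e
        exact Ideal.zero_mem _
      · refine Ideal.subset_span ?_
        simp only [List.mem_append, List.mem_cons, Set.mem_ofPred_eq] at hp ⊢
        tauto

/-- The cancelled monomial occurs in `f`, so the subtracted multiple of `g` is homogeneous of the
degree of `f`. -/
lemma InterreduceStep.homogeneous {L L' : List (MvPolynomial (Fin n) k)}
    (h : InterreduceStep ord L L') (hL : ∀ p ∈ L, ∃ e : ℕ, p.IsHomogeneous e) :
    ∀ p ∈ L', ∃ e : ℕ, p.IsHomogeneous e := by
  cases h with
  | reduce A B f g t hg hg0 ht =>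
    intro p hp
    have hmem : ∀ q, q ∈ A ++ B ∨ q = f → ∃ e : ℕ, q.IsHomogeneous e := fun q hq => hL q (by
      simp only [List.mem_append, List.mem_cons] at hq ⊢
      tauto)
    by_cases e : p = f - monomial t (f.coeff (t + ord.degree g) / ord.leadingCoeff g) * g
    · subst e
      obtain ⟨e, he⟩ := hmem f (.inr rfl)
      obtain ⟨e', he'⟩ := hmem g (.inl hg)
      refine ⟨e, he.sub ?_⟩
      have h1 : (t + ord.degree g).degree = e := by
        have := he (mem_support_iff.1 ht)
        rwa [Finsupp.degree_eq_weight_one]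
      rw [map_add, degree_degree_of_isHomogeneous he' hg0] at h1
      exact h1 ▸ (isHomogeneous_monomial _ rfl).mul he'
    · refine hmem p (.inl ?_)
      simp only [List.mem_append, List.mem_cons] at hp ⊢
      tauto
  | drop A B =>
    intro p hp
    refine hL p ?_
    simp only [List.mem_append, List.mem_cons] at hp ⊢
    tauto

lemma zero_notMem_of_interreduced {L : List (MvPolynomial (Fin n) k)}
    (h : ∀ L', ¬ InterreduceStep ord L L') : (0 : MvPolynomial (Fin n) k) ∉ L := by
  intro h0
  obtain ⟨A, B, rfl⟩ := List.append_of_mem h0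
  exact h _ (.drop A B)

end Interreduction
end F5GEN

/-! ### The main theorem. -/

theorem mainTheorem5 {k : Type*} [Field k] {n : ℕ} (ord : MonomialOrder (Fin n))
    (F : List (MvPolynomial (Fin n) k)) :
    F5GEN.Terminates (F5GEN.InterreduceStep ord) F ∧
    ∀ (d : ℕ) (f : Fin d → MvPolynomial (Fin n) k), F5GEN.IsSortedInterreduction ord F f →
      (∀ so : F5GEN.ModuleOrder n d, so.Compatible ord →
        F5GEN.ComputesGroebnerBasis ord so f (Ideal.span {p | p ∈ F})) ∧
      ((∀ p ∈ F, ∃ e : ℕ, p.IsHomogeneous e) →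
        F5GEN.ComputesGroebnerBasis ord (F5GEN.f5Order ord f) f (Ideal.span {p | p ∈ F})) := by
  refine ⟨F5GEN.terminates_interreduceStep F, fun d f ⟨⟨L, hFL, hL, hperm⟩, _⟩ => ?_⟩
  have hmem : ∀ i, f i ∈ L := fun i => hperm.subset (List.mem_ofFn.2 ⟨i, rfl⟩)
  have hf0 : ∀ i, f i ≠ 0 := fun i e => F5GEN.zero_notMem_of_interreduced hL (e ▸ hmem i)
  have hrange : Set.range f = {p | p ∈ L} := by
    ext p
    rw [Set.mem_ofPred_eq, ← hperm.mem_iff, List.mem_ofFn, Set.mem_range]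
  have hspan : Ideal.span {p | p ∈ F} = Ideal.span (Set.range f) := by
    rw [hrange]
    clear hL hperm hmem hrange
    induction hFL with
    | refl => rfl
    | tail _ h ih => exact ih.trans h.span_eq.symm
  rw [hspan]
  refine ⟨fun so hso => F5GEN.computesGroebnerBasis_of_ne_zero hf0 (.inl hso), fun hF =>
    F5GEN.computesGroebnerBasis_of_ne_zero hf0 (.inr ⟨rfl, ?_⟩)⟩
  suffices h : ∀ p ∈ L, ∃ e : ℕ, p.IsHomogeneous e from fun i => h _ (hmem i)
  clear hL hperm hmem hrange hspan
  induction hFL with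
  | refl => exact hF
  | tail _ h ih => exact h.homogeneous ih
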